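/- Let $\mathbb{F}_2^n$ be the space of column vectors, and identify invertible matrices in $\mathrm{GL}(n,\mathbb{F}_2)$ with the linear permutations they define. For $F\colon\mathbb{F}_2^n\to\mathbb{F}_2^n$ let $\Gamma_F=\{(x,F(x))\}\subseteq\mathbb{F}_2^{2n}$, and let $\mathsf{Aut_{LE}}(F)$ be the group of all block-diagonal matrices $\mathrm{diag}(A,B)$ with $A,B\in\mathrm{GL}(n,\mathbb{F}_2)$ that map $\Gamma_F$ onto itself (equivalently $F\circ A=B\circ F$). $G$ is linear equivalent to $F$ if $F\circ A=B\circ G$ for some $A,B\in\mathrm{GL}(n,\mathbb{F}_2)$. Write $M\sim M'$ if $M'=P^{-1}MP$ for some $P\in\mathrm{GL}(n,\mathbb{F}_2)$. For matrices of the same prime order, $(A,B)\sim_p(C,D)$ (power-similar) means that $A\sim C^i$ and $B\sim D^i$ for some integer $i\ge 1$; $(A,B)$ and $(C,D)$ are extended power-similar if $(A,B)\sim_p(C,D)$ or $(A^{-1},B^{-1})\sim_p(D,C)$. For $q=X^d+q_{d-1}X^{d-1}+\dots+q_0\in\mathbb{F}_2[X]$ write $[q]=\mathrm{Comp}(q)$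 for the $d\times d$ companion matrix with ones on the first subdiagonal, last column $(q_0,\dots,q_{d-1})^{\top}$ and zeros elsewhere; $\oplus$ is the block-diagonal sum, the first summand being the upper left block, and $I_k$ is the $k\times k$ identity matrix. A matrix is in rational canonical form if it equals $[q_r]\oplus\dots\oplus[q_1]$ with monic non-constant polynomials $q_r\mid q_{r-1}\mid\dots\mid q_1$. For $n\in\{6,7,8\}$ consider the following lists of pairs $(B,A)$ of matrices in $\mathrm{GL}(n,\mathbb{F}_2)$. For $n=6$ (17 pairs): 1. $B=[X^6+X^5+X^4+X^3+X+1]$, $A=[X^6+X^3+X^2+1]$ 2. $B=[X^6+X^5+X^4+X^3+X+1]$, $A=[X^6+X^5+X^3+X^2+X+1]$ 3. $B=[X^6+X^5+X^4+X^3+X+1]$, $A=[X^6+X^5+X^4+1]$ 4. $B=A=[X^6+X^5+X^4+X^3+X+1]$ 5. $B=A=[X^6+X^5+X^4+X^3+X^2+X+1]$ 6. $B=A=I_1 \oplus [X^5+1]$ 7. $B=I_2 \oplus [X^4+X^3+X^2+1]$, $A=I_2 \oplus [X^4+X^2+X+1]$ 8. $B=A=I_2 \oplus [X^4+X^3+X^2+1]$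 9. $B=A=[X^3+1] \oplus [X^3+1]$ 10. $B=[X^3+X^2+1] \oplus [X^3+X^2+1]$, $A=[X^6+X^5+X^4+X^3+X^2+X+1]$ 11. $B=[X^3+X^2+1] \oplus [X^3+X^2+1]$, $A=[X^3+X+1] \oplus [X^3+X+1]$ 12. $B=A=[X^3+X^2+1] \oplus [X^3+X^2+1]$ 13. $B=A=I_3 \oplus [X^3+1]$ 14. $B=A=[X^2+1] \oplus [X^2+1] \oplus [X^2+1]$ 15. $B=A=[X^2+X+1] \oplus [X^2+X+1] \oplus [X^2+X+1]$ 16. $B=A=I_2 \oplus [X^2+1] \oplus [X^2+1]$ 17. $B=A=I_4 \oplus [X^2+1]$ For $n=7$ (27 pairs): 1. $B=A=[X^7+1]$ 2. $B=[X^7+X^6+X^5+X^4+X^3+X^2+1]$, $A=[X^7+X^3+1]$ 3. $B=[X^7+X^6+X^5+X^4+X^3+X^2+1]$, $A=[X^7+X^5+X^3+X+1]$ 4. $B=[X^7+X^6+X^5+X^4+X^3+X^2+1]$, $A=[X^7+X^5+X^4+X^3+X^2+X+1]$ 5. $B=[X^7+X^6+X^5+X^4+X^3+X^2+1]$, $A=[X^7+X^6+1]$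 6. $B=[X^7+X^6+X^5+X^4+X^3+X^2+1]$, $A=[X^7+X^6+X^4+X+1]$ 7. $B=[X^7+X^6+X^5+X^4+X^3+X^2+1]$, $A=[X^7+X^6+X^5+X^2+1]$ 8. $B=[X^7+X^6+X^5+X^4+X^3+X^2+1]$, $A=[X^7+X^6+X^5+X^3+X^2+X+1]$ 9. $B=[X^7+X^6+X^5+X^4+X^3+X^2+1]$, $A=[X^7+X^6+X^5+X^4+1]$ 10. $B=[X^7+X^6+X^5+X^4+X^3+X^2+1]$, $A=[X^7+X^6+X^5+X^4+X^2+X+1]$ 11. $B=A=[X^7+X^6+X^5+X^4+X^3+X^2+1]$ 12. $B=I_1 \oplus [X^6+X^5+X^4+X^3+X+1]$, $A=I_1 \oplus [X^6+X^3+X^2+1]$ 13. $B=I_1 \oplus [X^6+X^5+X^4+X^3+X+1]$, $A=I_1 \oplus [X^6+X^5+X^3+X^2+X+1]$ 14. $B=I_1 \oplus [X^6+X^5+X^4+X^3+X+1]$, $A=I_1 \oplus [X^6+X^5+X^4+1]$ 15. $B=A=I_1 \oplus [X^6+X^5+X^4+X^3+X+1]$ 16. $B=A=I_2 \oplus [X^5+1]$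 17. $B=[X^3+X+1] \oplus [X^4+X^3+X^2+1]$, $A=[X^7+1]$ 18. $B=[X^3+X+1] \oplus [X^4+X^3+X^2+1]$, $A=[X^3+X^2+1] \oplus [X^4+X^2+X+1]$ 19. $B=A=[X^3+X+1] \oplus [X^4+X^3+X^2+1]$ 20. $B=I_3 \oplus [X^4+X^3+X^2+1]$, $A=I_3 \oplus [X^4+X^2+X+1]$ 21. $B=A=I_3 \oplus [X^4+X^3+X^2+1]$ 22. $B=A=I_1 \oplus [X^3+1] \oplus [X^3+1]$ 23. $B=A=[X^2+X+1] \oplus [X^2+X+1] \oplus [X^3+1]$ 24. $B=A=I_4 \oplus [X^3+1]$ 25. $B=A=I_1 \oplus [X^2+1] \oplus [X^2+1] \oplus [X^2+1]$ 26. $B=A=I_3 \oplus [X^2+1] \oplus [X^2+1]$ 27. $B=A=I_5 \oplus [X^2+1]$ For $n=8$ (32 pairs): 1. $B=[X^8+X^7+X^6+X^4+X^2+X+1]$, $A=[X^8+X^5+X^4+X^3+1]$ 2. $B=A=[X^8+X^7+X^6+X^4+X^2+X+1]$ 3. $B=[X^8+X^7+X^6+X^5+X^4+X^3+X^2+1]$,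 $A=[X^8+X^6+X^4+X^3+X^2+1]$ 4. $B=[X^8+X^7+X^6+X^5+X^4+X^3+X^2+1]$, $A=[X^8+X^6+X^5+X^4+X^2+1]$ 5. $B=[X^8+X^7+X^6+X^5+X^4+X^3+X^2+1]$, $A=[X^8+X^6+X^5+X^4+X^3+X^2+X+1]$ 6. $B=[X^8+X^7+X^6+X^5+X^4+X^3+X^2+1]$, $A=[X^8+X^7+X^4+X^3+X+1]$ 7. $B=[X^8+X^7+X^6+X^5+X^4+X^3+X^2+1]$, $A=[X^8+X^7+X^5+X^2+X+1]$ 8. $B=[X^8+X^7+X^6+X^5+X^4+X^3+X^2+1]$, $A=[X^8+X^7+X^5+X^4+X+1]$ 9. $B=[X^8+X^7+X^6+X^5+X^4+X^3+X^2+1]$, $A=[X^8+X^7+X^6+1]$ 10. $B=[X^8+X^7+X^6+X^5+X^4+X^3+X^2+1]$, $A=[X^8+X^7+X^6+X^3+X+1]$ 11. $B=[X^8+X^7+X^6+X^5+X^4+X^3+X^2+1]$, $A=[X^8+X^7+X^6+X^5+X^3+1]$ 12. $B=A=[X^8+X^7+X^6+X^5+X^4+X^3+X^2+1]$ 13. $B=A=I_1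 \oplus [X^7+1]$ 14. $B=I_2 \oplus [X^6+X^5+X^4+X^3+X+1]$, $A=I_2 \oplus [X^6+X^3+X^2+1]$ 15. $B=I_2 \oplus [X^6+X^5+X^4+X^3+X+1]$, $A=I_2 \oplus [X^6+X^5+X^3+X^2+X+1]$ 16. $B=I_2 \oplus [X^6+X^5+X^4+X^3+X+1]$, $A=I_2 \oplus [X^6+X^5+X^4+1]$ 17. $B=A=I_2 \oplus [X^6+X^5+X^4+X^3+X+1]$ 18. $B=A=I_3 \oplus [X^5+1]$ 19. $B=[X^4+X^3+X^2+1] \oplus [X^4+X^3+X^2+1]$, $A=I_1 \oplus [X^7+1]$ 20. $B=[X^4+X^3+X^2+1] \oplus [X^4+X^3+X^2+1]$, $A=[X^4+X^2+X+1] \oplus [X^4+X^2+X+1]$ 21. $B=A=[X^4+X^3+X^2+1] \oplus [X^4+X^3+X^2+1]$ 22. $B=A=[X^4+X^3+X^2+X+1] \oplus [X^4+X^3+X^2+X+1]$ 23. $B=I_4 \oplus [X^4+X^3+X^2+1]$, $A=I_4 \oplus [X^4+X^2+X+1]$ 24. $B=A=I_4 \oplus [X^4+X^3+X^2+1]$ 25.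 $B=A=[X^2+X+1] \oplus [X^3+1] \oplus [X^3+1]$ 26. $B=A=I_2 \oplus [X^3+1] \oplus [X^3+1]$ 27. $B=A=I_5 \oplus [X^3+1]$ 28. $B=A=[X^2+1] \oplus [X^2+1] \oplus [X^2+1] \oplus [X^2+1]$ 29. $B=A=[X^2+X+1] \oplus [X^2+X+1] \oplus [X^2+X+1] \oplus [X^2+X+1]$ 30. $B=A=I_2 \oplus [X^2+1] \oplus [X^2+1] \oplus [X^2+1]$ 31. $B=A=I_4 \oplus [X^2+1] \oplus [X^2+1]$ 32. $B=A=I_6 \oplus [X^2+1]$ Then for each $n\in\{6,7,8\}$ the following hold. (a) The list has $17$, $27$, $32$ distinct members for $n=6,7,8$, respectively; in each listed pair, $B$ and $A$ have the same prime order and are in rational canonical form; and no two distinct listed pairs are extended power-similar. (b) If $F$ is a permutation of $\mathbb{F}_2^n$ and $\mathrm{diag}(A,B)\in\mathsf{Aut_{LE}}(F)$ with $A$ and $B$ of the same prime order, then $(B,A)$ is extended power-similar to a listed pair. (c) For every permutation $F$ of $\mathbb{F}_2^n$ with non-trivial $\mathsf{Aut_{LE}}(F)$ there are a permutation $G$ of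 $\mathbb{F}_2^n$, linear equivalent to $F$ or to $F^{-1}$, and a listed pair $(B,A)$ with $\mathrm{diag}(A,B)\in\mathsf{Aut_{LE}}(G)$. -/

import Mathlib

open Polynomial

namespace LinSelfEquiv

/-- The field with two elements. -/
abbrev F2 : Type := ZMod 2

/-- The vector space `F_2^n` of column vectors. -/
abbrev V (n : ℕ) : Type := Fin n → F2

/-- The group of invertible `n × n` matrices over `F_2`. -/
abbrev GLn (n : ℕ) : Type := GL (Fin n) F2

/-! ### Automorphisms and linear equivalence of functions on `F_2^n` -/

/-- The graph `{(x, F x)}` of `F`, a subset of `F_2^n × F_2^n = F_2^(2n)`. -/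
def graph {n : ℕ} (F : V n → V n) : Set (V n × V n) := {z | z.2 = F z.1}

/-- The automorphism group of `F`: all affine permutations of `F_2^(2n)` that map the graph of `F`
onto itself. -/
def Aut {n : ℕ} (F : V n → V n) : Subgroup ((V n × V n) ≃ᵃ[F2] (V n × V n)) where
  carrier := {σ | graph F = σ '' graph F}
  one_mem' := by simp [AffineEquiv.one_def]
  mul_mem' := by
    intro σ τ hσ hτ
    simp only [Set.mem_ofPred_eq] at hσ hτ ⊢
    rw [AffineEquiv.coe_mul, Set.image_comp, ← hτ, ← hσ]
  inv_mem' := by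
    intro σ hσ
    simp only [Set.mem_ofPred_eq] at hσ ⊢
    conv_rhs => rw [hσ, ← Set.image_comp]
    simp [AffineEquiv.inv_def]

/-- The linear permutation `x ↦ M x` of `F_2^n`. -/
def linPerm {n : ℕ} (M : GLn n) : V n ≃ₗ[F2] V n :=
  LinearMap.GeneralLinearGroup.generalLinearEquiv F2 (V n) (Matrix.GeneralLinearGroup.toLin M)

theorem linPerm_apply {n : ℕ} (M : GLn n) (x : V n) :
    linPerm M x = (M : Matrix (Fin n) (Fin n) F2).mulVec x := by
  rfl

/-- For `(A, B)`, the block-diagonal matrix with diagonal blocks `A` and `B`, as the permutation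
`(x, y) ↦ (A x, B y)` of `F_2^(2n)`. -/
def blockDiag {n : ℕ} : GLn n × GLn n →* ((V n × V n) ≃ᵃ[F2] (V n × V n)) where
  toFun s := ((linPerm s.1).prodCongr (linPerm s.2)).toAffineEquiv
  map_one' := by
    ext z <;> simp [linPerm_apply]
  map_mul' s t := by
    ext z <;> simp [linPerm_apply, AffineEquiv.mul_def]

theorem blockDiag_apply {n : ℕ} (A B : GLn n) (x y : V n) :
    blockDiag (A, B) (x, y) = ((A : Matrix (Fin n) (Fin n) F2).mulVec x,
      (B : Matrix (Fin n) (Fin n) F2).mulVec y) := by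
  rfl

/-- The group of LE-automorphisms of `F`: the automorphisms of the form `diag(A, B)` with
`A, B ∈ GL(n, F_2)`. -/
def AutLE {n : ℕ} (F : V n → V n) : Subgroup ((V n × V n) ≃ᵃ[F2] (V n × V n)) :=
  Aut F ⊓ blockDiag.range

/-- `G` is linear equivalent to `F`: `F ∘ A = B ∘ G` for some `A, B ∈ GL(n, F_2)`. -/
def LinearEquivalent {n : ℕ} (G F : V n → V n) : Prop :=
  ∃ A B : GLn n, F ∘ linPerm A = linPerm B ∘ G

/-! ### Similarity and power-similarity -/

/-- Similarity of invertible matrices, `M' = P⁻¹ M P`. -/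
def Similar {n : ℕ} (M M' : GLn n) : Prop := ∃ P : GLn n, M' = P⁻¹ * M * P

/-- Power-similarity of pairs (used for matrices of the same prime order). -/
def PowerSimilar {n : ℕ} (s t : GLn n × GLn n) : Prop :=
  ∃ i : ℕ, 0 < i ∧ Similar s.1 (t.1 ^ i) ∧ Similar s.2 (t.2 ^ i)

/-- Extended power-similarity of pairs: `(A, B)` is power-similar to `(C, D)`, or `(A⁻¹, B⁻¹)` is
power-similar to `(D, C)`. -/
def ExtPowerSimilar {n : ℕ} (s t : GLn n × GLn n) : Prop :=
  PowerSimilar s t ∨ PowerSimilar (s.1⁻¹, s.2⁻¹) (t.2, t.1)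

/-! ### Companion matrices and rational canonical form -/

/-- The companion matrix of a monic polynomial `q = X^d + q_{d-1} X^{d-1} + ... + q_0` over `F_2`:
ones below the diagonal and last column `(q_0, ..., q_{d-1})`. -/
def Comp (q : F2[X]) : Matrix (Fin q.natDegree) (Fin q.natDegree) F2 :=
  Matrix.of fun i j =>
    if (j : ℕ) + 1 = q.natDegree then q.coeff i
    else if (i : ℕ) = (j : ℕ) + 1 then 1 else 0

/-- The block-diagonal matrix `Comp q₁ ⊕ Comp q₂ ⊕ ... ⊕ Comp q_k` of a list `[q₁, q₂, ..., q_k]`;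
the first polynomial gives the block in the upper left corner. -/
def compSum (qs : List F2[X]) :
    Matrix (Fin (∑ k : Fin qs.length, (qs.get k).natDegree))
      (Fin (∑ k : Fin qs.length, (qs.get k).natDegree)) F2 :=
  Matrix.reindex finSigmaFinEquiv finSigmaFinEquiv
    (Matrix.blockDiagonal' fun k : Fin qs.length => Comp (qs.get k))

/-- The `n × n` matrix `M` is the direct sum of the companion matrices of the listed
polynomials (in particular, their degrees add up to `n`). -/
def IsCompSum {n : ℕ} (M : Matrix (Fin n) (Fin n) F2) (qs : List F2[X]) : Prop :=
  ∃ h : ∑ k : Fin qs.length, (qs.get k).natDegree = n,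
    M = Matrix.reindex (finCongr h) (finCongr h) (compSum qs)

/-- `M` is in rational canonical form: it is `Comp q_r ⊕ ... ⊕ Comp q_1` for monic non-constant
polynomials with `q_r ∣ ... ∣ q_1`. -/
def IsRCF {n : ℕ} (M : GLn n) : Prop :=
  ∃ qs : List F2[X], (∀ q ∈ qs, q.Monic ∧ 0 < q.natDegree) ∧ qs.IsChain (· ∣ ·) ∧
    IsCompSum (M : Matrix (Fin n) (Fin n) F2) qs

/-! ### The explicit list of pairs -/

/-- The polynomial `X^e₁ + X^e₂ + ...` with the listed exponents. -/
noncomputable def poly (es : List ℕ) : F2[X] := (es.map fun e => X ^ e).sum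

/-- The matrix `M` is the direct sum of the companion matrices of the polynomials given by the
listed lists of exponents. For example `[[1, 0], [5, 0]]` stands for
`Comp (X + 1) ⊕ Comp (X^5 + 1)`. -/
def IsMatrixOf {n : ℕ} (M : GLn n) (e : List (List ℕ)) : Prop :=
  IsCompSum (M : Matrix (Fin n) (Fin n) F2) (e.map poly)

/-- The identity matrix `I_k`, as the direct sum of `k` copies of the `1 × 1` matrix
`Comp (X + 1) = (1)`. -/
def ones (k : ℕ) : List (List ℕ) := List.replicate k [1, 0]

/-- A pair `(B, A)` with `B = A`. -/
def same (e : List (List ℕ)) : List (List ℕ) × List (List ℕ) := (e, e)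

/-- The pairs `(B, A)` for `n = 6`. -/
def table6 : List (List (List ℕ) × List (List ℕ)) := [
  ([[6, 5, 4, 3, 1, 0]],
    [[6, 3, 2, 0]]),
  ([[6, 5, 4, 3, 1, 0]],
    [[6, 5, 3, 2, 1, 0]]),
  ([[6, 5, 4, 3, 1, 0]],
    [[6, 5, 4, 0]]),
  same ([[6, 5, 4, 3, 1, 0]]),
  same ([[6, 5, 4, 3, 2, 1, 0]]),
  same (ones 1 ++ [[5, 0]]),
  (ones 2 ++ [[4, 3, 2, 0]],
    ones 2 ++ [[4, 2, 1, 0]]),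
  same (ones 2 ++ [[4, 3, 2, 0]]),
  same ([[3, 0], [3, 0]]),
  ([[3, 2, 0], [3, 2, 0]],
    [[6, 5, 4, 3, 2, 1, 0]]),
  ([[3, 2, 0], [3, 2, 0]],
    [[3, 1, 0], [3, 1, 0]]),
  same ([[3, 2, 0], [3, 2, 0]]),
  same (ones 3 ++ [[3, 0]]),
  same ([[2, 0], [2, 0], [2, 0]]),
  same ([[2, 1, 0], [2, 1, 0], [2, 1, 0]]),
  same (ones 2 ++ [[2, 0], [2, 0]]),
  same (ones 4 ++ [[2, 0]])]

/-- The pairs `(B, A)` for `n = 7`. -/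
def table7 : List (List (List ℕ) × List (List ℕ)) := [
  same ([[7, 0]]),
  ([[7, 6, 5, 4, 3, 2, 0]],
    [[7, 3, 0]]),
  ([[7, 6, 5, 4, 3, 2, 0]],
    [[7, 5, 3, 1, 0]]),
  ([[7, 6, 5, 4, 3, 2, 0]],
    [[7, 5, 4, 3, 2, 1, 0]]),
  ([[7, 6, 5, 4, 3, 2, 0]],
    [[7, 6, 0]]),
  ([[7, 6, 5, 4, 3, 2, 0]],
    [[7, 6, 4, 1, 0]]),
  ([[7, 6, 5, 4, 3, 2, 0]],
    [[7, 6, 5, 2, 0]]),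
  ([[7, 6, 5, 4, 3, 2, 0]],
    [[7, 6, 5, 3, 2, 1, 0]]),
  ([[7, 6, 5, 4, 3, 2, 0]],
    [[7, 6, 5, 4, 0]]),
  ([[7, 6, 5, 4, 3, 2, 0]],
    [[7, 6, 5, 4, 2, 1, 0]]),
  same ([[7, 6, 5, 4, 3, 2, 0]]),
  (ones 1 ++ [[6, 5, 4, 3, 1, 0]],
    ones 1 ++ [[6, 3, 2, 0]]),
  (ones 1 ++ [[6, 5, 4, 3, 1, 0]],
    ones 1 ++ [[6, 5, 3, 2, 1, 0]]),
  (ones 1 ++ [[6, 5, 4, 3, 1, 0]],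
    ones 1 ++ [[6, 5, 4, 0]]),
  same (ones 1 ++ [[6, 5, 4, 3, 1, 0]]),
  same (ones 2 ++ [[5, 0]]),
  ([[3, 1, 0], [4, 3, 2, 0]],
    [[7, 0]]),
  ([[3, 1, 0], [4, 3, 2, 0]],
    [[3, 2, 0], [4, 2, 1, 0]]),
  same ([[3, 1, 0], [4, 3, 2, 0]]),
  (ones 3 ++ [[4, 3, 2, 0]],
    ones 3 ++ [[4, 2, 1, 0]]),
  same (ones 3 ++ [[4, 3, 2, 0]]),
  same (ones 1 ++ [[3, 0], [3, 0]]),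
  same ([[2, 1, 0], [2, 1, 0], [3, 0]]),
  same (ones 4 ++ [[3, 0]]),
  same (ones 1 ++ [[2, 0], [2, 0], [2, 0]]),
  same (ones 3 ++ [[2, 0], [2, 0]]),
  same (ones 5 ++ [[2, 0]])]

/-- The pairs `(B, A)` for `n = 8`. -/
def table8 : List (List (List ℕ) × List (List ℕ)) := [
  ([[8, 7, 6, 4, 2, 1, 0]],
    [[8, 5, 4, 3, 0]]),
  same ([[8, 7, 6, 4, 2, 1, 0]]),
  ([[8, 7, 6, 5, 4, 3, 2, 0]],
    [[8, 6, 4, 3, 2, 0]]),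
  ([[8, 7, 6, 5, 4, 3, 2, 0]],
    [[8, 6, 5, 4, 2, 0]]),
  ([[8, 7, 6, 5, 4, 3, 2, 0]],
    [[8, 6, 5, 4, 3, 2, 1, 0]]),
  ([[8, 7, 6, 5, 4, 3, 2, 0]],
    [[8, 7, 4, 3, 1, 0]]),
  ([[8, 7, 6, 5, 4, 3, 2, 0]],
    [[8, 7, 5, 2, 1, 0]]),
  ([[8, 7, 6, 5, 4, 3, 2, 0]],
    [[8, 7, 5, 4, 1, 0]]),
  ([[8, 7, 6, 5, 4, 3, 2, 0]],
    [[8, 7, 6, 0]]),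
  ([[8, 7, 6, 5, 4, 3, 2, 0]],
    [[8, 7, 6, 3, 1, 0]]),
  ([[8, 7, 6, 5, 4, 3, 2, 0]],
    [[8, 7, 6, 5, 3, 0]]),
  same ([[8, 7, 6, 5, 4, 3, 2, 0]]),
  same (ones 1 ++ [[7, 0]]),
  (ones 2 ++ [[6, 5, 4, 3, 1, 0]],
    ones 2 ++ [[6, 3, 2, 0]]),
  (ones 2 ++ [[6, 5, 4, 3, 1, 0]],
    ones 2 ++ [[6, 5, 3, 2, 1, 0]]),
  (ones 2 ++ [[6, 5, 4, 3, 1, 0]],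
    ones 2 ++ [[6, 5, 4, 0]]),
  same (ones 2 ++ [[6, 5, 4, 3, 1, 0]]),
  same (ones 3 ++ [[5, 0]]),
  ([[4, 3, 2, 0], [4, 3, 2, 0]],
    ones 1 ++ [[7, 0]]),
  ([[4, 3, 2, 0], [4, 3, 2, 0]],
    [[4, 2, 1, 0], [4, 2, 1, 0]]),
  same ([[4, 3, 2, 0], [4, 3, 2, 0]]),
  same ([[4, 3, 2, 1, 0], [4, 3, 2, 1, 0]]),
  (ones 4 ++ [[4, 3, 2, 0]],
    ones 4 ++ [[4, 2, 1, 0]]),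
  same (ones 4 ++ [[4, 3, 2, 0]]),
  same ([[2, 1, 0], [3, 0], [3, 0]]),
  same (ones 2 ++ [[3, 0], [3, 0]]),
  same (ones 5 ++ [[3, 0]]),
  same ([[2, 0], [2, 0], [2, 0], [2, 0]]),
  same ([[2, 1, 0], [2, 1, 0], [2, 1, 0], [2, 1, 0]]),
  same (ones 2 ++ [[2, 0], [2, 0], [2, 0]]),
  same (ones 4 ++ [[2, 0], [2, 0]]),
  same (ones 6 ++ [[2, 0]])]

/-- The table for `n` (only the values `6`, `7`, `8` are of interest). -/
def table (n : ℕ) : List (List (List ℕ) × List (List ℕ)) :=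
  if n = 6 then table6 else if n = 7 then table7 else if n = 8 then table8 else []

/-- The listed pairs `(B, A)` of elements of `GL(n, F_2)`. -/
def classes (n : ℕ) : Set (GLn n × GLn n) :=
  {s | ∃ e ∈ table n, IsMatrixOf s.1 e.1 ∧ IsMatrixOf s.2 e.2}

end LinSelfEquiv

/-!
If `diag(A, B)` maps the graph of a permutation `F` onto itself, then `F ∘ A = B ∘ F`, so `F` carries
the fixed vectors of `A` to those of `B`. Hence the fixed spaces of `A` and `B` have the same
dimension, and this is the only restriction used: it remains to classify pairs `(B, A)` of matrices
of prime order `p` with fixed spaces of equal dimension, up to extended power-similarity.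

*Similarity classes.* A matrix `M` with `M^p = 1` makes `F_2^n` a module over `F_2[X]` killed by
`X^p - 1`, and by the structure theorem over a principal ideal domain (`exists_decomp`) this is a
product of modules `F_2[X] / (g i)` with prime powers `g i ∣ X^p - 1`. For a field `K` over `F_2`
and `c : K`, the eigenfunctionals `F_2^n → K` of `M` for `c` form a space whose dimension `mult M c`
is the number of `i` with `g i (c) = 0` (`Decomp.mult_eq`). If `p` is odd, then `X^p - 1` is
squarefree, and the multiplicities of the `p`-th roots of unity determine the similarity class of
`M`. If `p = 2`, the multiplicity of `1` does. As `mult (M^i) (c^i) = mult M c` for `i` prime to `p`,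
and `mult M (c^2) = mult M c`, the similarity class of `M` is recorded by a list of labels, the type
of `M` (`HasType`): the orbits of `c ↦ 2 c` on the nonzero residues modulo `p` whose roots of unity
occur as eigenvalues, with multiplicity. (For `p = 2` there is one label, and it counts the Jordan
blocks of size `2`.) Passing to the `i`-th power multiplies the labels by `i` (`HasType.pow`).

*Listed matrices.* A companion matrix describes multiplication by the root of its polynomial
(`equivFun_symm_comp_mulVec`), so the type of a direct sum of companion matrices can be read off the
roots of the polynomials among the `p`-th roots of unity (`IsCompSum.hasType`). These roots are found
by computing with the powers of a root of one fixed irreducible factor of `X^p - 1`, written as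
binary numbers.

*Conclusion.* Only `2, 3, 5, 7, 17, 31, 127` divide the order of `GL(8, F_2)`. For each of these
primes everything becomes a finite statement about pairs of lists of labels, of equal length `m` with
`blockDim p * m ≤ n`: each pair is related to the pair of an entry of the table by a multiplication
and possibly a swap (`exists_related`), and no two entries are related in this way
(`pairwise_typedTable`). Finally, if `B` and `A` are similar to powers of `C` and `D`, then
conjugating `F` by the transforming matrices gives a permutation with the automorphism `diag(D, C)`
(`exists_linearEquivalent`); a swap corresponds to passing from `F` to its inverse.
-/

namespace LinSelfEquiv

/-! ### Eigenfunctionals -/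

section Eigenfunctionals

variable {K : Type*} [Field K] [Algebra F2 K]
  {W W' : Type*} [AddCommGroup W] [Module F2 W] [AddCommGroup W'] [Module F2 W']

/-- The `K`-space of eigenfunctionals of `T` for `c`: the `F_2`-linear maps `φ : W → K` with
`φ ∘ T = c φ`. It plays the part of the `c`-eigenspace of the transpose of `T` over `K`. -/
def eig (T : W →ₗ[F2] W) (c : K) : Submodule K (W →ₗ[F2] K) where
  carrier := {φ | ∀ w, φ (T w) = c * φ w}
  add_mem' := by
    intro φ ψ hφ hψ w
    simp only [Set.mem_ofPred_eq] at hφ hψ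
    simp [hφ w, hψ w, mul_add]
  zero_mem' := by intro w; simp
  smul_mem' := by
    intro a φ hφ w
    simp only [Set.mem_ofPred_eq] at hφ
    simp [hφ w, mul_left_comm]

theorem mem_eig {T : W →ₗ[F2] W} {c : K} {φ : W →ₗ[F2] K} :
    φ ∈ eig T c ↔ ∀ w, φ (T w) = c * φ w := Iff.rfl

theorem finrank_eig_congr {T : W →ₗ[F2] W} {T' : W' →ₗ[F2] W'} (f : W ≃ₗ[F2] W')
    (h : ∀ w, f (T w) = T' (f w)) (c : K) :
    Module.finrank K (eig T c) = Module.finrank K (eig T' c) := by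
  refine LinearEquiv.finrank_eq
    { toFun := fun φ => ⟨φ.1 ∘ₗ f.symm.toLinearMap, fun w => ?_⟩
      invFun := fun φ => ⟨φ.1 ∘ₗ f.toLinearMap, fun w => ?_⟩
      map_add' := fun φ ψ => ?_
      map_smul' := fun a φ => ?_
      left_inv := fun φ => ?_
      right_inv := fun φ => ?_ }
  · have : f.symm (T' w) = T (f.symm w) := by
      rw [LinearEquiv.symm_apply_eq, h, LinearEquiv.apply_symm_apply]
    simp [this, mem_eig.1 φ.2]
  · rfl
  · rfl
  · simp [h, mem_eig.1 φ.2]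
  · exact Subtype.ext (LinearMap.ext fun w => by simp)
  · exact Subtype.ext (LinearMap.ext fun w => by simp)

end Eigenfunctionals

/-! ### Decompositions into cyclic modules and multiplicities -/

section Decomposition

variable {K : Type*} [Field K] [Algebra F2 K] {n : ℕ} {ι : Type}

/-- `Decomp M g` says that `F_2^n`, with `X` acting as `M`, is isomorphic as an `F_2[X]`-module to
the product of the cyclic modules `F_2[X] / (g i)`. -/
def Decomp (M : Matrix (Fin n) (Fin n) F2) (g : ι → F2[X]) : Prop :=
  ∃ f : V n ≃ₗ[F2] ((i : ι) → AdjoinRoot (g i)),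
    ∀ v i, f (M.mulVec v) i = AdjoinRoot.root (g i) * f v i

theorem Decomp.aeval_mulVec {M : Matrix (Fin n) (Fin n) F2} {g : ι → F2[X]}
    {f : V n ≃ₗ[F2] ((i : ι) → AdjoinRoot (g i))}
    (hf : ∀ v i, f (M.mulVec v) i = AdjoinRoot.root (g i) * f v i) (q : F2[X]) (v : V n) (i : ι) :
    f ((aeval M q).mulVec v) i = AdjoinRoot.mk (g i) q * f v i := by
  induction q using Polynomial.induction_on generalizing v with
  | C a =>
    rw [aeval_C, Algebra.algebraMap_eq_smul_one, Matrix.smul_mulVec, Matrix.one_mulVec, map_smul,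
      AdjoinRoot.mk_C, Pi.smul_apply, Algebra.smul_def]
    rfl
  | add p q hp hq => rw [map_add, Matrix.add_mulVec, map_add, Pi.add_apply, hp, hq, map_add,
      add_mul]
  | monomial k a h =>
    rw [pow_succ, ← mul_assoc, map_mul, aeval_X, ← Matrix.mulVec_mulVec, h, hf,
      map_mul _ (C a * X ^ k), AdjoinRoot.mk_X, mul_assoc]

/-- A polynomial divisible by all `g i` annihilates `M`. -/
theorem Decomp.aeval_eq_zero {M : Matrix (Fin n) (Fin n) F2} {g : ι → F2[X]} (h : Decomp M g)
    {q : F2[X]} (hq : ∀ i, g i ∣ q) : aeval M q = 0 := by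
  obtain ⟨f, hf⟩ := h
  apply Matrix.mulVec_injective
  funext v
  apply f.injective
  funext i
  rw [Decomp.aeval_mulVec hf, AdjoinRoot.mk_eq_zero.2 (hq i)]
  simp

theorem Decomp.sum_natDegree [Fintype ι] {M : Matrix (Fin n) (Fin n) F2} {g : ι → F2[X]}
    (h : Decomp M g) (hg : ∀ i, (g i).Monic) : ∑ i, (g i).natDegree = n := by
  obtain ⟨f, -⟩ := h
  have h1 := f.finrank_eq
  have (i : ι) : Module.Free F2 (AdjoinRoot (g i)) := (hg i).free_adjoinRoot
  have (i : ι) : Module.Finite F2 (AdjoinRoot (g i)) := (hg i).finite_adjoinRoot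
  rw [Module.finrank_fin_fun, Module.finrank_pi_fintype] at h1
  conv_rhs => rw [h1]
  refine Finset.sum_congr rfl fun i _ => ?_
  have := (AdjoinRoot.powerBasis' (hg i)).finrank
  rw [this, AdjoinRoot.powerBasis'_dim]

/-- The multiplicity of `c` as an eigenvalue of `M`, measured by eigenfunctionals. -/
noncomputable def mult (M : Matrix (Fin n) (Fin n) F2) (c : K) : ℕ :=
  Module.finrank K (eig M.mulVecLin c)

/-- An eigenfunctional of `∏ F_2[X] / (g i)` for `c` is determined by its values at the generators
of the factors with `g i (c) = 0`, which may be prescribed; it vanishes on all other factors. -/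
theorem Decomp.mult_eq [Fintype ι] {M : Matrix (Fin n) (Fin n) F2} {g : ι → F2[X]}
    (h : Decomp M g) (c : K) :
    mult M c = Nat.card {i // aeval c (g i) = 0} := by
  classical
  obtain ⟨f, hf⟩ := h
  set r : (i : ι) → AdjoinRoot (g i) := fun i => AdjoinRoot.root (g i) with hr
  rw [mult, finrank_eig_congr (T' := LinearMap.mulLeft F2 r) f (fun w => funext fun i => hf w i)]
  set S := {i // aeval c (g i) = 0}
  have key : ∀ φ : eig (LinearMap.mulLeft F2 r) c, ∀ i (q : F2[X]),
      φ.1 (Pi.single i (AdjoinRoot.mk (g i) q)) = aeval c q * φ.1 (Pi.single i 1) := by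
    intro φ i q
    induction q using Polynomial.induction_on with
    | C a =>
      have : (Pi.single i (AdjoinRoot.mk (g i) (C a)) : (i : ι) → AdjoinRoot (g i))
          = a • Pi.single i 1 := by
        rw [← Pi.single_smul, AdjoinRoot.mk_C, Algebra.smul_def, mul_one]
        rfl
      rw [this, map_smul, aeval_C, Algebra.smul_def]
    | add p q hp hq => rw [map_add, Pi.single_add, map_add, hp, hq, map_add, add_mul]
    | monomial k a h =>
      have : (Pi.single i (AdjoinRoot.mk (g i) (C a * X ^ (k + 1))) : (i : ι) → AdjoinRoot (g i))
          = LinearMap.mulLeft F2 r (Pi.single i (AdjoinRoot.mk (g i) (C a * X ^ k))) := by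
        rw [LinearMap.mulLeft_apply, mul_comm r, ← Pi.single_mul_left, pow_succ,
          ← mul_assoc, map_mul _ (C a * X ^ k), AdjoinRoot.mk_X]
      rw [this, mem_eig.1 φ.2, h, pow_succ, ← mul_assoc (C a), map_mul _ _ X, aeval_X]
      ring
  let Φ : eig (LinearMap.mulLeft F2 r) c →ₗ[K] (S → K) :=
    { toFun := fun φ i => φ.1 (Pi.single i.1 1)
      map_add' := fun φ ψ => by ext; simp
      map_smul' := fun a φ => by ext; simp }
  have hΦ φ s : Φ φ s = φ.1 (Pi.single s.1 1) := rfl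
  have hinj : Function.Injective Φ := by
    intro φ ψ hφ
    refine Subtype.ext (LinearMap.pi_ext fun i x => ?_)
    obtain ⟨q, rfl⟩ := AdjoinRoot.mk_surjective x
    suffices φ.1 (Pi.single i 1) = ψ.1 (Pi.single i 1) by rw [key, key, this]
    by_cases hi : aeval c (g i) = 0
    · exact congrFun hφ ⟨i, hi⟩
    · have h0 (χ : eig (LinearMap.mulLeft F2 r) c) : χ.1 (Pi.single i 1) = 0 := by
        have := key χ i (g i)
        rw [AdjoinRoot.mk_self, Pi.single_zero, map_zero] at this
        exact (mul_eq_zero.1 this.symm).resolve_left hi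
      rw [h0, h0]
  have hsurj : Function.Surjective Φ := by
    intro y
    let ev (s : S) : AdjoinRoot (g s.1) →ₐ[F2] K :=
      AdjoinRoot.liftAlgHom (g s.1) (Algebra.ofId F2 K) c s.2
    refine ⟨⟨∑ s : S, y s • ((ev s).toLinearMap ∘ₗ LinearMap.proj s.1), fun w => ?_⟩, ?_⟩
    · simp only [LinearMap.sum_apply, LinearMap.smul_apply, LinearMap.comp_apply,
        LinearMap.proj_apply, LinearMap.mulLeft_apply, AlgHom.toLinearMap_apply, Pi.mul_apply,
        map_mul, Finset.mul_sum, smul_eq_mul]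
      refine Finset.sum_congr rfl fun s _ => ?_
      have : ev s (r s.1) = c := AdjoinRoot.liftAlgHom_root ..
      rw [this]
      ring
    · funext t
      rw [hΦ, LinearMap.sum_apply, Finset.sum_eq_single t]
      · simp
      · intro s _ hs
        have : s.1 ≠ t.1 := fun h => hs (Subtype.ext h)
        simp [this]
      · simp
  rw [(LinearEquiv.ofBijective Φ ⟨hinj, hsurj⟩).finrank_eq, Module.finrank_fintype_fun_eq_card,
    Nat.card_eq_fintype_card]

end Decomposition

/-! ### Existence of decompositions and similarity -/

section Decomposition

variable {n : ℕ} {ι ι' : Type}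

/-- A matrix annihilated by a nonzero polynomial `q` decomposes `F_2^n` into nonzero cyclic modules
`F_2[X] / (g i)`, where the `g i` are prime powers dividing `q`. -/
theorem exists_decomp (M : Matrix (Fin n) (Fin n) F2) {q : F2[X]} (hq : q ≠ 0)
    (h : aeval M q = 0) :
    ∃ (ι : Type) (_ : Fintype ι) (g : ι → F2[X]), (∀ i, (g i).Monic ∧ g i ∣ q ∧
      ∃ (p : F2[X]) (e : ℕ), Irreducible p ∧ p.Monic ∧ 0 < e ∧ g i = p ^ e) ∧ Decomp M g := by
  classical
  -- the structure theorem is applied to `F_2^n` with `X` acting as `M`; it may produce trivial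
  -- factors `p i ^ 0`, which are then left out
  set φ : Module.End F2 (V n) := Matrix.toLinAlgEquiv' M with hφ
  have hφM (v : V n) : φ v = M.mulVec v := Matrix.toLinAlgEquiv'_apply M v
  have hkill (x : Module.AEval' φ) : q • x = 0 := by
    obtain ⟨v, rfl⟩ := (Module.AEval'.of φ).surjective x
    have : aeval φ q = 0 := by
      rw [hφ, ← AlgEquiv.coe_toAlgHom, aeval_algHom_apply, h, map_zero]
    rw [← Module.AEval.of_aeval_smul, this, zero_smul, map_zero]
  have htor : Module.IsTorsion F2[X] (Module.AEval' φ) := fun x =>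
    ⟨⟨q, mem_nonZeroDivisors_of_ne_zero hq⟩, hkill x⟩
  obtain ⟨ι, hι, p, hp, e, ⟨E⟩⟩ := Module.equiv_directSum_of_isTorsion htor
  have hmon (i : ι) : (p i).Monic := by
    have h0 : (p i).leadingCoeff ≠ 0 := leadingCoeff_ne_zero.2 (hp i).ne_zero
    have : ∀ a : F2, a ≠ 0 → a = 1 := by decide
    exact this _ h0
  refine ⟨{i // 0 < e i}, inferInstance, fun i => p i.1 ^ e i.1, fun i =>
    ⟨(hmon i).pow _, ?_, p i, e i, hp i, hmon i, i.2, rfl⟩, ?_⟩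
  · have h1 := hkill (E.symm (DirectSum.of (fun i => F2[X] ⧸ F2[X] ∙ p i ^ e i) i.1
      (Submodule.Quotient.mk 1)))
    rw [← map_smul, LinearEquiv.map_eq_zero_iff] at h1
    have h2 := DFunLike.congr_fun h1 i.1
    rw [DirectSum.smul_apply, DirectSum.of_eq_same, ← Submodule.Quotient.mk_smul,
      DirectSum.zero_apply, Submodule.Quotient.mk_eq_zero, smul_eq_mul, mul_one,
      Submodule.mem_span_singleton] at h2
    obtain ⟨a, ha⟩ := h2
    exact ⟨a, by rw [← ha, smul_eq_mul, mul_comm]⟩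
  · have hsub (i : ι) (hi : ¬ 0 < e i) (x y : F2[X] ⧸ F2[X] ∙ p i ^ e i) : x = y := by
      have : Subsingleton (F2[X] ⧸ F2[X] ∙ p i ^ e i) := by
        rw [Submodule.Quotient.subsingleton_iff, Nat.eq_zero_of_not_pos hi, pow_zero]
        exact Ideal.span_singleton_one
      exact Subsingleton.elim _ _
    let f : V n →+ ((i : {i // 0 < e i}) → AdjoinRoot (p i.1 ^ e i.1)) :=
      { toFun := fun v i => (E (Module.AEval'.of φ v) i.1 : F2[X] ⧸ F2[X] ∙ p i.1 ^ e i.1)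
        map_zero' := by funext i; simp; rfl
        map_add' := fun v w => by funext i; simp; rfl }
    have hf v i : f v i = (E (Module.AEval'.of φ v) i.1 : F2[X] ⧸ F2[X] ∙ p i.1 ^ e i.1) := rfl
    have hbij : Function.Bijective (f.toZModLinearMap 2) := by
      constructor
      · intro v w hvw
        apply (Module.AEval'.of φ).injective
        apply E.injective
        refine DFinsupp.ext fun i => ?_
        by_cases hi : 0 < e i
        · exact congrFun hvw ⟨i, hi⟩
        · exact hsub i hi _ _
      · intro y
        let y' (i : ι) : F2[X] ⧸ F2[X] ∙ p i ^ e i := if hi : 0 < e i then y ⟨i, hi⟩ else 0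
        refine ⟨(Module.AEval'.of φ).symm (E.symm (DFinsupp.equivFunOnFintype.symm y')), ?_⟩
        funext i
        rw [AddMonoidHom.coe_toZModLinearMap, hf, LinearEquiv.apply_symm_apply,
          LinearEquiv.apply_symm_apply]
        exact dif_pos i.2
    refine ⟨LinearEquiv.ofBijective _ hbij, fun v i => ?_⟩
    have hroot (y : AdjoinRoot (p i.1 ^ e i.1)) :
        @HSMul.hSMul F2[X] (F2[X] ⧸ F2[X] ∙ p i.1 ^ e i.1) _ _ X y
          = AdjoinRoot.root (p i.1 ^ e i.1) * y := by
      obtain ⟨r, rfl⟩ := AdjoinRoot.mk_surjective y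
      rfl
    rw [LinearEquiv.ofBijective_apply, LinearEquiv.ofBijective_apply,
      AddMonoidHom.coe_toZModLinearMap, hf, hf, ← hφM, ← Module.AEval'.X_smul_of, map_smul]
    exact hroot _

theorem Decomp.reindex {M : Matrix (Fin n) (Fin n) F2} {g : ι → F2[X]} (h : Decomp M g)
    (σ : ι' ≃ ι) : Decomp M (g ∘ σ) := by
  obtain ⟨f, hf⟩ := h
  exact ⟨f.trans (LinearEquiv.piCongrLeft' F2 (fun i => AdjoinRoot (g i)) σ.symm),
    fun v i => hf v (σ i)⟩

theorem Decomp.similar {M M' : GLn n} {g : ι → F2[X]}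
    (h : Decomp (M : Matrix (Fin n) (Fin n) F2) g)
    (h' : Decomp (M' : Matrix (Fin n) (Fin n) F2) g) : Similar M M' := by
  obtain ⟨f, hf⟩ := h
  obtain ⟨f', hf'⟩ := h'
  let Q : V n ≃ₗ[F2] V n := f.trans f'.symm
  have hQ (v : V n) : Q ((M : Matrix (Fin n) (Fin n) F2).mulVec v)
      = (M' : Matrix (Fin n) (Fin n) F2).mulVec (Q v) := by
    apply f'.injective
    funext i
    simp [Q, hf, hf']
  let P : GLn n := Matrix.GeneralLinearGroup.toLin.symm
    ((LinearMap.GeneralLinearGroup.generalLinearEquiv F2 (V n)).symm Q)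
  have hP (v : V n) : (P : Matrix (Fin n) (Fin n) F2).mulVec v = Q v := by
    rw [← linPerm_apply, linPerm, MulEquiv.apply_symm_apply, MulEquiv.apply_symm_apply]
  refine ⟨P⁻¹, ?_⟩
  rw [inv_inv, eq_mul_inv_iff_mul_eq]
  apply Units.ext
  apply Matrix.mulVec_injective
  funext v
  simp only [Units.val_mul, ← Matrix.mulVec_mulVec, hP, hQ]

end Decomposition

/-! ### Companion matrices -/

section Companion

/-- The companion matrix of `q` is the matrix of multiplication by the root of `q` with respect to
the basis `1, X, …, X^(d-1)` of `F_2[X] / (q)`. -/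
theorem equivFun_symm_comp_mulVec {q : F2[X]} (hq : q.Monic) (u : Fin q.natDegree → F2) :
    (AdjoinRoot.powerBasisAux' hq).equivFun.symm ((Comp q).mulVec u)
      = AdjoinRoot.root q * (AdjoinRoot.powerBasisAux' hq).equivFun.symm u := by
  set b := AdjoinRoot.powerBasisAux' hq
  have hb (i) : b i = AdjoinRoot.root q ^ (i : ℕ) := (AdjoinRoot.powerBasis' hq).basis_eq_pow i
  suffices b.equivFun.symm.toLinearMap ∘ₗ (Comp q).mulVecLin
      = LinearMap.mulLeft F2 (AdjoinRoot.root q) ∘ₗ b.equivFun.symm.toLinearMap from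
    LinearMap.congr_fun this u
  refine LinearMap.pi_ext' fun j => LinearMap.ext_ring ?_
  simp only [LinearMap.comp_apply, LinearMap.single_apply, Matrix.mulVecLin_apply,
    Matrix.mulVec_single_one, LinearEquiv.coe_coe, Module.Basis.equivFun_symm_apply,
    LinearMap.mulLeft_apply, hb]
  have hR : ∑ x, (Pi.single j 1 : Fin q.natDegree → F2) x • AdjoinRoot.root q ^ (x : ℕ)
      = AdjoinRoot.root q ^ (j : ℕ) := by
    rw [Finset.sum_eq_single j] <;> simp +contextual
  rw [hR, ← pow_succ']
  by_cases hj : (j : ℕ) + 1 = q.natDegree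
  · have h0 : aeval (AdjoinRoot.root q) q = 0 := by simp
    rw [aeval_eq_sum_range, Finset.sum_range_succ, hq.coeff_natDegree, one_smul,
      Finset.sum_range] at h0
    rw [hj, ← ZModModule.neg_eq_self (AdjoinRoot.root q ^ q.natDegree),
      ← eq_neg_of_add_eq_zero_left h0]
    refine Finset.sum_congr rfl fun i _ => ?_
    simp [Comp, hj]
  · have hlt : (j : ℕ) + 1 < q.natDegree := by omega
    rw [Finset.sum_eq_single ⟨(j : ℕ) + 1, hlt⟩]
    · simp [Comp, hj]
    · intro i _ hi
      have : (i : ℕ) ≠ j + 1 := fun h => hi (Fin.ext h)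
      simp [Comp, hj, this]
    · simp

theorem IsCompSum.decomp {n : ℕ} {M : Matrix (Fin n) (Fin n) F2} {qs : List F2[X]}
    (h : IsCompSum M qs) (hqs : ∀ q ∈ qs, q.Monic) :
    Decomp M fun k : Fin qs.length => qs.get k := by
  obtain ⟨h, rfl⟩ := h
  subst h
  have hm (k : Fin qs.length) : (qs.get k).Monic := hqs _ (List.get_mem ..)
  let f := (LinearEquiv.funCongrLeft F2 F2
      (finSigmaFinEquiv (n := fun k : Fin qs.length => (qs.get k).natDegree))).trans
    ((LinearEquiv.piCurry F2 fun (k : Fin qs.length) (_ : Fin (qs.get k).natDegree) => F2).trans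
    (LinearEquiv.piCongrRight fun k => (AdjoinRoot.powerBasisAux' (hm k)).equivFun.symm))
  refine ⟨f, fun v k => ?_⟩
  change (AdjoinRoot.powerBasisAux' (hm k)).equivFun.symm _
    = _ * (AdjoinRoot.powerBasisAux' (hm k)).equivFun.symm _
  rw [← equivFun_symm_comp_mulVec]
  congr 1
  funext i
  change ∑ j, compSum qs (finSigmaFinEquiv ⟨k, i⟩) j * v j
    = ∑ j, Comp (qs.get k) i j * v (finSigmaFinEquiv ⟨k, j⟩)
  rw [← finSigmaFinEquiv.sum_comp, Fintype.sum_sigma, Finset.sum_eq_single k]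
  · simp [compSum]
  · intro k' _ hk
    refine Finset.sum_eq_zero fun j _ => ?_
    simp [compSum, Matrix.blockDiagonal'_apply_ne _ _ _ hk.symm]
  · simp

end Companion

/-! ### Multiplicities of roots of unity -/

section Multiplicity

variable {K : Type*} [Field K] [Algebra F2 K] {n p : ℕ} {ζ : K}
  {M M' : Matrix (Fin n) (Fin n) F2}

theorem aeval_X_pow_sub_one (h : M ^ p = 1) : aeval M (X ^ p - 1 : F2[X]) = 0 := by
  simp [h]

theorem natDegree_X_pow_sub_one (p : ℕ) : (X ^ p - 1 : F2[X]).natDegree = p := by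
  rw [← C_1, natDegree_X_pow_sub_C]

theorem monic_X_pow_sub_one (hp : p ≠ 0) : (X ^ p - 1 : F2[X]).Monic := by
  rw [← C_1]; exact monic_X_pow_sub_C 1 hp

theorem squarefree_X_pow_sub_one (hp : Odd p) : Squarefree (X ^ p - 1 : F2[X]) := by
  apply Separable.squarefree
  rw [X_pow_sub_one_separable_iff, Ne, ZMod.natCast_eq_zero_iff]
  exact hp.not_two_dvd_nat

/-- For odd `p`, a matrix with `M ^ p = 1` is semisimple. -/
theorem exists_decomp_irreducible (hp : Odd p) (h : M ^ p = 1) :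
    ∃ (ι : Type) (_ : Fintype ι) (g : ι → F2[X]),
      (∀ i, (g i).Monic ∧ g i ∣ X ^ p - 1 ∧ Irreducible (g i)) ∧ Decomp M g := by
  obtain ⟨ι, _, g, hg, hd⟩ := exists_decomp M (monic_X_pow_sub_one hp.pos.ne').ne_zero
    (aeval_X_pow_sub_one h)
  refine ⟨ι, inferInstance, g, fun i => ⟨(hg i).1, (hg i).2.1, ?_⟩, hd⟩
  obtain ⟨-, h1, q, e, hq, -, he, h2⟩ := hg i
  rw [h2] at h1 ⊢
  have := ((squarefree_X_pow_sub_one hp).squarefree_of_dvd h1).eq_zero_or_one_of_pow_of_not_isUnit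
    hq.not_isUnit
  obtain rfl : e = 1 := by omega
  rwa [pow_one]

theorem aeval_sq (q : F2[X]) (c : K) : aeval (c ^ 2) q = aeval c q ^ 2 := by
  rw [← map_pow, ← ZMod.expand_card, expand_aeval]

theorem aeval_pow_two_pow_eq_zero {q : F2[X]} {c : K} (j : ℕ) :
    aeval (c ^ 2 ^ j) q = 0 ↔ aeval c q = 0 := by
  induction j with
  | zero => simp
  | succ j ih => rw [pow_succ, pow_mul, aeval_sq, sq_eq_zero_iff, ih]

/-- Multiplicities are constant on orbits of the Frobenius map. -/
theorem mult_pow_two_pow (hp : Odd p) (h : M ^ p = 1) (c : K) (j : ℕ) :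
    mult M (c ^ 2 ^ j) = mult M c := by
  obtain ⟨ι, _, g, -, hd⟩ := exists_decomp_irreducible hp h
  simp_rw [hd.mult_eq, aeval_pow_two_pow_eq_zero]

open Classical in
theorem card_roots_le (hζ : IsPrimitiveRoot ζ p) {g : F2[X]} (hg : g ≠ 0) :
    ((Finset.range p).filter fun a => aeval (ζ ^ a) g = 0).card ≤ g.natDegree := by
  classical
  have h0 : g.map (algebraMap F2 K) ≠ 0 := by simpa using hg
  rw [← natDegree_map (algebraMap F2 K)]
  refine le_trans ?_ (card_roots' _)
  refine le_trans ?_ (Multiset.toFinset_card_le _)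
  refine Finset.card_le_card_of_injOn (fun a => ζ ^ a) (fun a ha => ?_) fun a ha b hb hab => ?_
  · rw [Finset.mem_coe, Finset.mem_filter] at ha
    simp [h0, IsRoot, ha.2, eval_map_algebraMap]
  · simp only [Finset.coe_filter, Finset.mem_range, Set.mem_ofPred_eq] at ha hb
    exact hζ.pow_inj ha.1 hb.1 hab

theorem aeval_X_pow_sub_one_pow (hζ : IsPrimitiveRoot ζ p) (a : ℕ) :
    aeval (ζ ^ a) (X ^ p - 1 : F2[X]) = 0 := by
  have : (ζ ^ a) ^ p = 1 := by rw [← pow_mul, mul_comm, pow_mul, hζ.pow_eq_one, one_pow]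
  simp [this]

open Classical in
/-- A divisor of `X ^ p - 1` has as many roots among the powers of `ζ` as its degree says. The
cofactor has at most as many roots as its degree too, and together they have all `p` roots. -/
theorem card_roots_eq (hp : p ≠ 0) (hζ : IsPrimitiveRoot ζ p) {g : F2[X]}
    (hg : g ∣ X ^ p - 1) :
    ((Finset.range p).filter fun a => aeval (ζ ^ a) g = 0).card = g.natDegree := by
  classical
  obtain ⟨h, hh⟩ := hg
  have h0 : g * h ≠ 0 := hh ▸ (monic_X_pow_sub_one hp).ne_zero
  have hdeg : g.natDegree + h.natDegree = p := by
    rw [← natDegree_mul (left_ne_zero_of_mul h0) (right_ne_zero_of_mul h0), ← hh,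
      natDegree_X_pow_sub_one]
  have h1 := card_roots_le hζ (left_ne_zero_of_mul h0)
  have h2 := card_roots_le hζ (right_ne_zero_of_mul h0)
  have h3 : (Finset.range p).card ≤ _ :=
    (Finset.card_le_card (t := ((Finset.range p).filter fun a => aeval (ζ ^ a) g = 0) ∪
      ((Finset.range p).filter fun a => aeval (ζ ^ a) h = 0)) fun a ha => by
        have := aeval_X_pow_sub_one_pow hζ a
        rw [hh, map_mul, mul_eq_zero] at this
        simpa [Finset.mem_range.1 ha] using this).trans (Finset.card_union_le _ _)
  rw [Finset.card_range] at h3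
  omega

/-- For odd `p`, the space is diagonalisable over `K` with `p`-th roots of unity as eigenvalues. -/
theorem sum_mult (hp : Odd p) (hζ : IsPrimitiveRoot ζ p) (h : M ^ p = 1) :
    ∑ a ∈ Finset.range p, mult M (ζ ^ a) = n := by
  classical
  obtain ⟨ι, _, g, hg, hd⟩ := exists_decomp_irreducible hp h
  refine Eq.trans ?_ (hd.sum_natDegree fun i => (hg i).1)
  simp_rw [hd.mult_eq, ← card_roots_eq hp.pos.ne' hζ (hg _).2.1, Finset.card_filter,
    Nat.card_eq_fintype_card, Fintype.card_subtype, Finset.card_filter]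
  exact Finset.sum_comm

theorem eig_le_eig_pow (c : K) (i : ℕ) : eig M.mulVecLin c ≤ eig (M ^ i).mulVecLin (c ^ i) := by
  intro φ hφ
  rw [mem_eig] at hφ ⊢
  simp only [Matrix.mulVecLin_apply] at hφ ⊢
  induction i with
  | zero => simp
  | succ i ih => intro w; rw [pow_succ, ← Matrix.mulVec_mulVec, ih, hφ, pow_succ, mul_assoc]

/-- Raising `M` to a power prime to its order raises the eigenvalues to that power. -/
theorem mult_pow (h : M ^ p = 1) {c : K} (hc : c ^ p = 1) {i : ℕ} (hi : i.Coprime p) :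
    mult (M ^ i) (c ^ i) = mult M c := by
  rcases Nat.lt_or_ge 1 p with hp | hp
  · obtain ⟨j, -, hj⟩ := Nat.exists_mul_mod_eq_one_of_coprime hi hp
    have hM : (M ^ i) ^ j = M := by
      rw [← pow_mul, ← Nat.div_add_mod (i * j) p, hj, pow_add, pow_mul, h]; simp
    have hc' : (c ^ i) ^ j = c := by
      rw [← pow_mul, ← Nat.div_add_mod (i * j) p, hj, pow_add, pow_mul, hc]; simp
    have h1 := eig_le_eig_pow (M := M ^ i) (c ^ i) j
    rw [hM, hc'] at h1
    rw [mult, mult, le_antisymm h1 (eig_le_eig_pow c i)]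
  · interval_cases p
    · obtain rfl : i = 1 := by simpa using hi
      simp
    · rw [pow_one] at h hc
      simp [h, hc]

/-- Eigenfunctionals for `1` are the functionals on the cokernel of `M - 1`, which has the same
dimension as the kernel. -/
theorem card_fixed (M : Matrix (Fin n) (Fin n) F2) :
    Nat.card {v // M.mulVec v = v} = 2 ^ mult M (1 : K) := by
  set T : V n →ₗ[F2] V n := M.mulVecLin - LinearMap.id
  have h1 : mult M (1 : K) = Module.finrank F2 (V n ⧸ LinearMap.range T) := by
    let b := Module.finBasis F2 (V n ⧸ LinearMap.range T)
    have e : ((V n ⧸ LinearMap.range T) →ₗ[F2] K) ≃ₗ[K] eig M.mulVecLin (1 : K) :=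
      { toFun := fun ψ => ⟨ψ ∘ₗ (LinearMap.range T).mkQ, fun w => by
          rw [one_mul, ← sub_eq_zero, ← map_sub]
          have : (LinearMap.range T).mkQ (M.mulVecLin w - w) = 0 := by
            rw [Submodule.mkQ_apply, Submodule.Quotient.mk_eq_zero]
            exact ⟨w, rfl⟩
          rw [LinearMap.comp_apply, this, map_zero]⟩
        invFun := fun φ => (LinearMap.range T).liftQ φ.1 (by
          rintro _ ⟨w, rfl⟩
          have := mem_eig.1 φ.2 w
          rw [LinearMap.mem_ker]
          simp only [T, LinearMap.sub_apply, map_sub, LinearMap.id_apply, this, one_mul, sub_self])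
        map_add' := fun _ _ => rfl
        map_smul' := fun _ _ => rfl
        left_inv := fun ψ => by ext; simp
        right_inv := fun φ => Subtype.ext (LinearMap.ext fun w => by simp) }
    rw [mult, ← e.finrank_eq, ← (b.constr K).finrank_eq, Module.finrank_fintype_fun_eq_card,
      Fintype.card_fin]
  have h2 : Module.finrank F2 (V n ⧸ LinearMap.range T) = Module.finrank F2 (LinearMap.ker T) := by
    have h3 := LinearMap.finrank_range_add_finrank_ker T
    have h4 := (LinearMap.range T).finrank_quotient_add_finrank
    omega
  have h5 : Nat.card (LinearMap.ker T) = 2 ^ Module.finrank F2 (LinearMap.ker T) := by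
    rw [Module.natCard_eq_pow_finrank (K := F2)]
    simp
  rw [h1, h2, ← h5]
  refine Nat.card_congr (Equiv.subtypeEquivRight fun v => ?_)
  simp [T, sub_eq_zero]

theorem eq_one_of_mult_one {M : Matrix (Fin n) (Fin n) F2} (h : mult M (1 : K) = n) : M = 1 := by
  have h1 := card_fixed (K := K) M
  have h2 : Nat.card (V n) = 2 ^ n := by simp
  rw [h, ← h2] at h1
  have h3 : Function.Surjective (Subtype.val : {v // M.mulVec v = v} → V n) :=
    (Function.Injective.bijective_of_nat_card_le Subtype.val_injective h1.ge).surjective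
  apply Matrix.mulVec_injective
  funext v
  obtain ⟨w, rfl⟩ := h3 v
  rw [w.2, Matrix.one_mulVec]

theorem Similar.mult_eq {A B : GLn n} (h : Similar A B) (c : K) :
    mult (A : Matrix (Fin n) (Fin n) F2) c = mult (B : Matrix (Fin n) (Fin n) F2) c := by
  obtain ⟨P, rfl⟩ := h
  refine finrank_eig_congr (linPerm P⁻¹) (fun w => ?_) c
  simp only [linPerm_apply, Matrix.mulVecLin_apply, Units.val_mul, Matrix.mulVec_mulVec, mul_assoc]
  rw [← Units.val_mul, ← Units.val_mul P, mul_inv_cancel]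
  simp

theorem Decomp.similar_of_card_fiber {ι ι' : Type} [Fintype ι] [Fintype ι'] {A B : GLn n}
    {g : ι → F2[X]} {g' : ι' → F2[X]} (h : Decomp (A : Matrix (Fin n) (Fin n) F2) g)
    (h' : Decomp (B : Matrix (Fin n) (Fin n) F2) g')
    (hc : ∀ f, Nat.card {i // g i = f} = Nat.card {i // g' i = f}) : Similar A B := by
  have e (f) : {i // g i = f} ≃ {i // g' i = f} := (Finite.card_eq.1 (hc f)).some
  have : g = g' ∘ Equiv.ofFiberEquiv e := funext fun i => (Equiv.ofFiberEquiv_map e i).symm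
  rw [this] at h
  exact h.similar (h'.reindex _)

/-- For odd `p`, the multiplicities of the `p`-th roots of unity determine the similarity class:
the multiplicity of `c` counts the cyclic summands belonging to the minimal polynomial of `c`. -/
theorem similar_of_mult_eq (hp : Odd p) (hζ : IsPrimitiveRoot ζ p) {A B : GLn n}
    (hA : (A : Matrix (Fin n) (Fin n) F2) ^ p = 1) (hB : (B : Matrix (Fin n) (Fin n) F2) ^ p = 1)
    (h : ∀ a, mult (A : Matrix (Fin n) (Fin n) F2) (ζ ^ a)
      = mult (B : Matrix (Fin n) (Fin n) F2) (ζ ^ a)) : Similar A B := by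
  classical
  obtain ⟨ι, _, g, hg, hd⟩ := exists_decomp_irreducible hp hA
  obtain ⟨ι', _, g', hg', hd'⟩ := exists_decomp_irreducible hp hB
  have key (f : F2[X]) (hf : f.Monic ∧ f ∣ X ^ p - 1 ∧ Irreducible f) :
      Nat.card {i // g i = f} = Nat.card {i // g' i = f} := by
    have h1 := card_roots_eq hp.pos.ne' hζ hf.2.1
    have h2 : f.natDegree ≠ 0 := hf.2.2.natDegree_pos.ne'
    rw [← h1, Finset.card_ne_zero] at h2
    obtain ⟨a, ha⟩ := h2
    have hroot := (Finset.mem_filter.1 ha).2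
    have huniq (q : F2[X]) (hq : q.Monic ∧ q ∣ X ^ p - 1 ∧ Irreducible q) :
        aeval (ζ ^ a) q = 0 ↔ q = f := by
      refine ⟨fun h3 => ?_, fun h3 => h3 ▸ hroot⟩
      rw [minpoly.eq_of_irreducible_of_monic hq.2.2 h3 hq.1,
        minpoly.eq_of_irreducible_of_monic hf.2.2 hroot hf.1]
    have h4 := h a
    rw [hd.mult_eq, hd'.mult_eq] at h4
    simpa only [huniq _ (hg _), huniq _ (hg' _)] using h4
  refine hd.similar_of_card_fiber hd' fun f => ?_
  by_cases h1 : ∃ i, g i = f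
  · obtain ⟨i, rfl⟩ := h1
    exact key _ (hg i)
  · by_cases h2 : ∃ i, g' i = f
    · obtain ⟨i, rfl⟩ := h2
      exact key _ (hg' i)
    · have : IsEmpty {i // g i = f} := ⟨fun i => h1 ⟨i.1, i.2⟩⟩
      have : IsEmpty {i // g' i = f} := ⟨fun i => h2 ⟨i.1, i.2⟩⟩
      simp

/-- An involution decomposes into `m` blocks `X - 1` or `(X - 1) ^ 2`, where `m` is the dimension
of its space of fixed vectors. -/
theorem exists_decomp_two (h : M ^ 2 = 1) :
    ∃ (ι : Type) (_ : Fintype ι) (g : ι → F2[X]), (∀ i, g i = X - 1 ∨ g i = (X - 1) ^ 2) ∧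
      Decomp M g ∧ mult M (1 : K) = Nat.card ι ∧
      Nat.card {i // g i = X - 1} + 2 * Nat.card {i // g i = (X - 1) ^ 2} = n ∧
      Nat.card {i // g i = X - 1} + Nat.card {i // g i = (X - 1) ^ 2} = Nat.card ι := by
  classical
  obtain ⟨ι, _, g, hg, hd⟩ := exists_decomp M (monic_X_pow_sub_one two_ne_zero).ne_zero
    (aeval_X_pow_sub_one h)
  have h2 : (X ^ 2 - 1 : F2[X]) = (X - 1) ^ 2 := by
    have : CharP F2[X] 2 := inferInstance
    rw [sub_pow_char, one_pow]
  have hmon : (X - 1 : F2[X]).Monic := by rw [← C_1]; exact monic_X_sub_C 1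
  have hdeg : (X - 1 : F2[X]).natDegree = 1 := by rw [← C_1]; exact natDegree_X_sub_C 1
  have hg' (i) : g i = X - 1 ∨ g i = (X - 1) ^ 2 := by
    obtain ⟨h1, h3, q, e, hq, hqm, he, h4⟩ := hg i
    rw [h2] at h3
    have h5 : q ∣ X - 1 := hq.prime.dvd_of_dvd_pow ((dvd_pow_self q he.ne').trans (h4 ▸ h3))
    have hirr : Irreducible (X - 1 : F2[X]) := by rw [← C_1]; exact irreducible_X_sub_C 1
    have h6 : q = X - 1 := eq_of_monic_of_associated hqm hmon (hq.associated_of_dvd hirr h5)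
    subst h6
    have h7 := natDegree_le_of_dvd h3 (hmon.pow 2).ne_zero
    rw [h4, hmon.natDegree_pow, hmon.natDegree_pow, hdeg] at h7
    have : e = 1 ∨ e = 2 := by omega
    rcases this with rfl | rfl <;> simp [h4]
  have hne : (X - 1 : F2[X]) ≠ (X - 1) ^ 2 := fun hh => by
    have := congrArg natDegree hh
    rw [hmon.natDegree_pow, hdeg] at this
    omega
  refine ⟨ι, inferInstance, g, hg', hd, ?_, ?_, ?_⟩
  · rw [hd.mult_eq]
    refine Nat.card_congr (Equiv.subtypeUnivEquiv fun i => ?_)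
    rcases hg' i with h | h <;> simp [h]
  · have h8 := hd.sum_natDegree fun i => (hg i).1
    refine Eq.trans ?_ h8
    simp only [Nat.card_eq_fintype_card, Fintype.card_subtype, Finset.card_filter, Finset.mul_sum,
      ← Finset.sum_add_distrib]
    refine Finset.sum_congr rfl fun i _ => ?_
    rcases hg' i with h | h <;> simp [h, hne, hne.symm, hmon.natDegree_pow, hdeg]
  · have hsum : Nat.card ι = ∑ i : ι, 1 := by simp
    rw [hsum]
    simp only [Nat.card_eq_fintype_card, Fintype.card_subtype, Finset.card_filter,
      ← Finset.sum_add_distrib]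
    refine Finset.sum_congr rfl fun i _ => ?_
    rcases hg' i with h | h <;> simp [h, hne, hne.symm]

theorem similar_of_mult_eq_two {A B : GLn n}
    (hA : (A : Matrix (Fin n) (Fin n) F2) ^ 2 = 1) (hB : (B : Matrix (Fin n) (Fin n) F2) ^ 2 = 1)
    (h : mult (A : Matrix (Fin n) (Fin n) F2) (1 : K)
      = mult (B : Matrix (Fin n) (Fin n) F2) (1 : K)) : Similar A B := by
  obtain ⟨ι, _, g, hg, hd, h1, h2, h3⟩ := exists_decomp_two (K := K) hA
  obtain ⟨ι', _, g', hg', hd', h1', h2', h3'⟩ := exists_decomp_two (K := K) hB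
  refine hd.similar_of_card_fiber hd' fun f => ?_
  by_cases hf : f = X - 1
  · subst hf; omega
  by_cases hf' : f = (X - 1) ^ 2
  · subst hf'; omega
  have : IsEmpty {i // g i = f} := ⟨fun i => by rcases hg i.1 with h | h <;> simp_all [i.2]⟩
  have : IsEmpty {i // g' i = f} := ⟨fun i => by rcases hg' i.1 with h | h <;> simp_all [i.2]⟩
  simp

theorem mult_two_le (h : M ^ 2 = 1) : mult M (1 : K) ≤ n ∧ n ≤ 2 * mult M (1 : K) := by
  obtain ⟨ι, _, g, hg, hd, h1, h2, h3⟩ := exists_decomp_two (K := K) h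
  omega

end Multiplicity

/-! ### Arithmetic of the labels modulo the odd primes -/

section Data

/-- The multiplicative order of `2` modulo the odd prime `p`: the degree of every irreducible factor
of `X^p - 1` other than `X - 1`. For `p = 2` it is the degree of `(X - 1)^2`. -/
def blockDim : ℕ → ℕ
  | 2 => 2 | 3 => 2 | 5 => 4 | 7 => 3 | 17 => 8 | 31 => 5 | 127 => 7 | _ => 0

/-- The exponents of the irreducible factor of `X^p - 1` whose root serves as the primitive `p`-th
root of unity. -/
def gen : ℕ → List ℕ
  | 3 => [2, 1, 0] | 5 => [4, 3, 2, 1, 0] | 7 => [3, 1, 0] | 17 => [8, 7, 6, 4, 2, 1, 0]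
  | 31 => [5, 3, 0] | 127 => [7, 6, 5, 4, 3, 2, 0] | _ => []

/-- Representatives of the orbits of `c ↦ 2 c` on the nonzero residues modulo `p`, that is, of the
Galois orbits of primitive `p`-th roots of unity. For `p = 2` the only label is `1`. -/
def reps : ℕ → List ℕ
  | 2 => [1] | 3 => [1] | 5 => [1] | 7 => [1, 3] | 17 => [1, 3] | 31 => [1, 3, 5, 7, 11, 15]
  | 127 => [1, 3, 5, 7, 9, 11, 13, 15, 19, 21, 23, 27, 29, 31, 43, 47, 55, 63] | _ => []

/-- The orbit of `r` under `c ↦ 2 c` modulo `p`. -/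
def orbit (p r : ℕ) : List ℕ := (List.range (blockDim p)).map fun j => r * 2 ^ j % p

/-- The representative of the orbit of `c`: its smallest element, with `m - (m - x)` for the minimum
of `m` and `x`. For `p = 2`, where doubling is not invertible, every residue stands for itself. -/
def rep (p c : ℕ) : ℕ :=
  if p = 2 then c % 2 else (orbit p c).foldl (fun m x => m - (m - x)) (c % p)

/-- The polynomial with the listed exponents, encoded by its value at `2`, without carries. -/
def code (es : List ℕ) : ℕ := es.foldr (fun e c => 2 ^ e ^^^ c) 0

/-- The binary code of `X^j` reduced modulo the polynomial `gen p`. -/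
def powCode (p j : ℕ) : ℕ :=
  Nat.rec 1 (fun _ z => if (2 * z).testBit (blockDim p) then (2 * z) ^^^ code (gen p) else 2 * z) j

/-- The binary code of the value of the polynomial with exponents `q` at `X^a`, modulo `gen p`. -/
def evalCode (p : ℕ) (q : List ℕ) (a : ℕ) : ℕ :=
  q.foldr (fun x c => powCode p (x * a % p) ^^^ c) 0

/-- The representatives `r` such that the `r`-th power of the chosen root of unity is a root of the
polynomial `q`. For `p = 2` the block `(X - 1)^2` gets the label `1`. -/
def rootReps (p : ℕ) (q : List ℕ) : List ℕ :=
  if p = 2 then (if q = [2, 0] then [1] else []) else (reps p).filter fun r => evalCode p q r = 0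

/-- The type of a direct sum of companion matrices: the labels of its non-trivial indecomposable
summands. -/
def blockType (p : ℕ) (e : List (List ℕ)) : List ℕ := e.flatMap (rootReps p)

/-- The effect on types of raising a matrix to the power `i`. -/
def act (p i : ℕ) (L : List ℕ) : List ℕ := L.map fun r => rep p (i * r % p)

/-- The odd primes that divide the order of `GL(8, F_2)`. -/
def oddPrimes : List ℕ := [3, 5, 7, 17, 31, 127]

/-- Together with `0`, the orbits of the representatives cover each residue exactly once. -/
theorem range_perm_orbits : ∀ p ∈ oddPrimes,
    (List.range p).Perm (0 :: (reps p).flatMap (orbit p)) := by decide +kernel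

theorem eq_of_mem_orbit : ∀ p ∈ oddPrimes, ∀ r ∈ reps p, ∀ r' ∈ reps p, r ∈ orbit p r' →
    r = r' := by
  decide +kernel

theorem reps_lt : ∀ p ∈ 2 :: oddPrimes, ∀ r ∈ reps p, 0 < r ∧ r < p := by decide +kernel

theorem rep_mem_orbit : ∀ p ∈ oddPrimes, ∀ c < p, rep p c ∈ orbit p c := by decide +kernel

theorem reps_nodup : ∀ p ∈ 2 :: oddPrimes, (reps p).Nodup := by decide +kernel

theorem act_reps_perm : ∀ p ∈ 2 :: oddPrimes, ∀ i < p, i ≠ 0 →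
    (act p i (reps p)).Perm (reps p) := by
  decide +kernel

theorem powCode_lt : ∀ p ∈ oddPrimes, ∀ j < p, powCode p j < 256 := by decide +kernel

theorem powCode_self : ∀ p ∈ oddPrimes, powCode p p = 1 := by decide +kernel

theorem gen_spec : ∀ p ∈ oddPrimes, ∃ t, gen p = blockDim p :: t ∧ (∀ x ∈ t, x < blockDim p) ∧
    0 < blockDim p ∧ blockDim p < 9 ∧ (gen p).length % 2 = 1 := by
  intro p hp
  fin_cases hp <;> exact ⟨_, rfl, by decide, by decide, by decide, by decide⟩

theorem rep_two_mul : ∀ p ∈ oddPrimes, ∀ c < p, rep p (2 * c % p) = rep p c := by decide +kernel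

theorem prime_of_mem : ∀ p ∈ oddPrimes, p.Prime ∧ Odd p := by decide +kernel
end Data

/-! ### Polynomials given by exponents, and their roots -/

section Polynomials

theorem poly_cons (d : ℕ) (t : List ℕ) : poly (d :: t) = X ^ d + poly t := by simp [poly]

theorem degree_poly_lt {d : ℕ} {t : List ℕ} (h : ∀ x ∈ t, x < d) : (poly t).degree < d := by
  induction t with
  | nil => simp [poly]
  | cons x t ih =>
    rw [poly_cons]
    refine (degree_add_le _ _).trans_lt (max_lt ?_ (ih fun y hy => h y (List.mem_cons_of_mem _ hy)))
    rw [degree_X_pow]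
    exact_mod_cast h x List.mem_cons_self

theorem poly_monic {d : ℕ} {t : List ℕ} (h : ∀ x ∈ t, x < d) : (poly (d :: t)).Monic := by
  rw [poly_cons]; exact monic_X_pow_add (degree_poly_lt h)

theorem poly_natDegree {d : ℕ} {t : List ℕ} (h : ∀ x ∈ t, x < d) :
    (poly (d :: t)).natDegree = d := by
  rw [poly_cons]
  refine natDegree_eq_of_degree_eq_some ?_
  rw [degree_add_eq_left_of_degree_lt] <;> rw [degree_X_pow]
  exact degree_poly_lt h

variable {K : Type*} [Field K]

/-- The element of `K` with binary code `n`: the sum of the `ζ^i` over the binary digits `i` of `n`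
(at most nine of them). -/
def val (ζ : K) (n : ℕ) : K := ∑ i ∈ Finset.range 9, if n.testBit i then ζ ^ i else 0

theorem val_zero (ζ : K) : val ζ 0 = 0 := by simp [val]

theorem val_two_mul (ζ : K) {n : ℕ} (h : n < 256) : val ζ (2 * n) = ζ * val ζ n := by
  have h8 : n.testBit 8 = false := Nat.testBit_lt_two_pow (by simpa using h)
  rw [val, val, Finset.sum_range_succ', Finset.sum_range_succ _ 8, h8, mul_add, Finset.mul_sum]
  simp [Nat.testBit_succ, pow_succ']

theorem val_two_pow (ζ : K) {e : ℕ} (h : e < 9) : val ζ (2 ^ e) = ζ ^ e := by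
  rw [val, Finset.sum_eq_single e]
  · simp
  · intro i _ hi
    simp [hi.symm]
  · simp [h]

variable [Algebra F2 K]

theorem aeval_poly (c : K) (es : List ℕ) : aeval c (poly es) = (es.map (c ^ ·)).sum := by
  simp [poly, map_list_sum, Function.comp_def]

theorem aeval_one_poly (es : List ℕ) : aeval (1 : K) (poly es) = es.length := by
  simp [aeval_poly]

theorem two_eq_zero : (2 : K) = 0 := by
  have h : (2 : F2) = 0 := rfl
  rw [← map_ofNat (algebraMap F2 K) 2, h, map_zero]

theorem aeval_one_poly_eq_zero (es : List ℕ) :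
    aeval (1 : K) (poly es) = 0 ↔ es.length % 2 = 0 := by
  rw [aeval_one_poly, ← Nat.div_add_mod es.length 2]
  rcases Nat.mod_two_eq_zero_or_one es.length with h | h <;> simp [h, two_eq_zero]

/-- Addition of codes is without carries, as `K` has characteristic `2`. -/
theorem val_xor (ζ : K) (m n : ℕ) : val ζ (m ^^^ n) = val ζ m + val ζ n := by
  rw [val, val, val, ← Finset.sum_add_distrib]
  refine Finset.sum_congr rfl fun i _ => ?_
  rw [Nat.testBit_xor]
  cases m.testBit i <;> cases n.testBit i <;> simp [← two_mul, two_eq_zero]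

theorem val_code (ζ : K) {es : List ℕ} (h : ∀ e ∈ es, e < 9) :
    val ζ (code es) = aeval ζ (poly es) := by
  rw [aeval_poly]
  induction es with
  | nil => simp [code, val_zero]
  | cons e es ih =>
    have h1 : code (e :: es) = 2 ^ e ^^^ code es := rfl
    rw [h1, val_xor, val_two_pow ζ (h e List.mem_cons_self),
      ih fun x hx => h x (List.mem_cons_of_mem _ hx)]
    simp

/-- `ζ` is a root of the polynomial `gen p`, for one of the odd primes under consideration. -/
def IsGenRoot (p : ℕ) (ζ : K) : Prop := p ∈ oddPrimes ∧ aeval ζ (poly (gen p)) = 0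

variable {p : ℕ} {ζ : K}

theorem exists_isGenRoot [IsAlgClosed K] (hp : p ∈ oddPrimes) : ∃ ζ : K, IsGenRoot p ζ := by
  obtain ⟨t, h1, h2, h3, -⟩ := gen_spec p hp
  have hd : (poly (gen p)).degree ≠ 0 := by
    rw [h1, degree_eq_natDegree (poly_monic h2).ne_zero, poly_natDegree h2]
    exact_mod_cast h3.ne'
  obtain ⟨ζ, hζ⟩ := IsAlgClosed.exists_aeval_eq_zero K _ hd
  exact ⟨ζ, hp, hζ⟩

theorem IsGenRoot.val_powCode (h : IsGenRoot p ζ) {j : ℕ} (hj : j ≤ p) :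
    val ζ (powCode p j) = ζ ^ j := by
  obtain ⟨t, h1, h2, h3, h4, -⟩ := gen_spec p h.1
  have hgen : val ζ (code (gen p)) = 0 := by
    rw [val_code, h.2]
    intro e he
    rw [h1] at he
    rcases List.mem_cons.1 he with rfl | he
    · exact h4
    · exact (h2 e he).trans h4
  induction j with
  | zero => simpa [powCode] using val_two_pow ζ (e := 0) (by norm_num)
  | succ j ih =>
    have h5 : powCode p (j + 1) = if (2 * powCode p j).testBit (blockDim p) then
        (2 * powCode p j) ^^^ code (gen p) else 2 * powCode p j := rfl
    have h6 : val ζ (2 * powCode p j) = ζ ^ (j + 1) := by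
      rw [val_two_mul ζ (powCode_lt p h.1 j hj), ih (Nat.le_of_succ_le hj), pow_succ']
    rw [h5]
    split_ifs
    · rw [val_xor, hgen, add_zero, h6]
    · exact h6

theorem IsGenRoot.isPrimitiveRoot (h : IsGenRoot p ζ) : IsPrimitiveRoot ζ p := by
  have hp := (prime_of_mem p h.1).1
  have h1 : ζ ^ p = 1 := by
    rw [← h.val_powCode le_rfl, powCode_self p h.1]
    simpa using val_two_pow ζ (e := 0) (by norm_num)
  have h2 : ζ ≠ 1 := by
    rintro rfl
    obtain ⟨t, -, -, -, -, h5⟩ := gen_spec p h.1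
    have := (aeval_one_poly_eq_zero (gen p)).1 h.2
    omega
  have := Fact.mk hp
  rw [← orderOf_eq_prime h1 h2]
  exact IsPrimitiveRoot.orderOf ζ

theorem IsGenRoot.aeval_eq_zero (h : IsGenRoot p ζ) {q : List ℕ} {a : ℕ}
    (hq : evalCode p q a = 0) : aeval (ζ ^ a) (poly q) = 0 := by
  have key : val ζ (evalCode p q a) = (q.map ((ζ ^ a) ^ ·)).sum := by
    clear hq
    induction q with
    | nil => simp [evalCode, val_zero]
    | cons x q ih =>
      have h1 : evalCode p (x :: q) a = powCode p (x * a % p) ^^^ evalCode p q a := rfl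
      have hp := (prime_of_mem p h.1).1.pos
      rw [h1, val_xor, ih, h.val_powCode (Nat.mod_lt _ hp).le, List.map_cons, List.sum_cons,
        ← pow_mul, mul_comm a x, ← pow_mod_orderOf ζ (x * a), ← h.isPrimitiveRoot.eq_orderOf]
  rw [aeval_poly, ← key, hq, val_zero]

end Polynomials

/-! ### Types of matrices of prime order -/

section Types

variable {K : Type*} [Field K] [Algebra F2 K] {p n : ℕ} {ζ : K}

theorem IsGenRoot.pow_mod (h : IsGenRoot p ζ) (m : ℕ) : ζ ^ (m % p) = ζ ^ m := by
  rw [← pow_mod_orderOf ζ m, ← h.isPrimitiveRoot.eq_orderOf]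

theorem IsGenRoot.exists_pow_eq (h : IsGenRoot p ζ) {a r : ℕ} (ha : a ∈ orbit p r) :
    ∃ j, ζ ^ a = (ζ ^ r) ^ 2 ^ j := by
  obtain ⟨j, -, rfl⟩ := List.mem_map.1 ha
  exact ⟨j, by rw [h.pow_mod, pow_mul]⟩

theorem IsGenRoot.aeval_eq_zero_of_mem_orbit (h : IsGenRoot p ζ) {q : F2[X]} {a r : ℕ}
    (ha : a ∈ orbit p r) : aeval (ζ ^ a) q = 0 ↔ aeval (ζ ^ r) q = 0 := by
  obtain ⟨j, hj⟩ := h.exists_pow_eq ha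
  rw [hj, aeval_pow_two_pow_eq_zero]

/-- The exponents in `q` are strictly below the leading one, and the degree of `q` equals the number
of its roots among the `p`-th roots of unity. For `p = 2` only `X + 1` and `X^2 + 1` qualify. -/
def PolyCheck (p : ℕ) (q : List ℕ) : Prop :=
  (∀ x ∈ q.tail, x < q.headD 0) ∧ 0 < q.headD 0 ∧ if p = 2 then q = [1, 0] ∨ q = [2, 0] else
    q.headD 0 = (if q.length % 2 = 0 then 1 else 0) + blockDim p * (rootReps p q).length

instance (p : ℕ) (q : List ℕ) : Decidable (PolyCheck p q) := by unfold PolyCheck; infer_instance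

theorem PolyCheck.exists_cons {q : List ℕ} (h : PolyCheck p q) :
    ∃ d t, q = d :: t ∧ (∀ x ∈ t, x < d) ∧ 0 < d := by
  obtain ⟨h1, h2, -⟩ := h
  cases q with
  | nil => simp at h2
  | cons d t => exact ⟨d, t, rfl, by simpa using h1, by simpa using h2⟩

theorem PolyCheck.monic {q : List ℕ} (h : PolyCheck p q) : (poly q).Monic := by
  obtain ⟨d, t, rfl, h1, -⟩ := h.exists_cons
  exact poly_monic h1

theorem PolyCheck.natDegree {q : List ℕ} (h : PolyCheck p q) : (poly q).natDegree = q.headD 0 := by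
  obtain ⟨d, t, rfl, h1, -⟩ := h.exists_cons
  exact poly_natDegree h1

theorem ne_two_of_mem (hp : p ∈ oddPrimes) : p ≠ 2 := by
  rintro rfl
  revert hp
  decide

open Classical in
/-- The roots of a polynomial that passes the check are the ones computed, since there are as many
of them as the degree allows. -/
theorem IsGenRoot.poly_spec (h : IsGenRoot p ζ) {q : List ℕ} (hq : PolyCheck p q) :
    poly q ∣ X ^ p - 1 ∧ ∀ r ∈ reps p, aeval (ζ ^ r) (poly q) = 0 ↔ r ∈ rootReps p q := by
  have hp2 := ne_two_of_mem h.1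
  have hpos := (prime_of_mem p h.1).1.pos
  have hd := hq.2.2
  rw [if_neg hp2] at hd
  have hperm := range_perm_orbits p h.1
  set Z : List ℕ := if q.length % 2 = 0 then [0] else [] with hZ
  set S : List ℕ := Z ++ (rootReps p q).flatMap (orbit p) with hS
  have hsubR : (rootReps p q).Sublist (reps p) := by
    rw [rootReps, if_neg hp2]; exact List.filter_sublist
  have hsub : S.Sublist ([0] ++ (reps p).flatMap (orbit p)) := by
    refine List.Sublist.append ?_ ?_
    · rw [hZ]; split_ifs <;> simp
    · exact hsubR.flatMap _
  have hnd : S.Nodup := hsub.nodup (hperm.nodup_iff.1 List.nodup_range)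
  have hlen : S.length = (poly q).natDegree := by
    rw [hq.natDegree, hd, hS, List.length_append, List.length_flatMap]
    congr 1
    · rw [hZ]; split_ifs <;> rfl
    · simp [orbit, mul_comm]
  have hroot (r : ℕ) (hr : r ∈ rootReps p q) : aeval (ζ ^ r) (poly q) = 0 := by
    rw [rootReps, if_neg hp2, List.mem_filter] at hr
    exact h.aeval_eq_zero (by simpa using hr.2)
  set T := (Finset.range p).filter fun a => aeval (ζ ^ a) (poly q) = 0 with hT
  have hST : S.toFinset ⊆ T := by
    intro a ha
    rw [List.mem_toFinset] at ha
    refine Finset.mem_filter.2 ⟨?_, ?_⟩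
    · rw [Finset.mem_range, ← List.mem_range]
      exact hperm.mem_iff.2 (hsub.subset ha)
    · rcases List.mem_append.1 ha with ha | ha
      · rw [hZ] at ha
        split_ifs at ha with h0
        · rw [List.mem_singleton.1 ha, pow_zero, aeval_one_poly_eq_zero, h0]
        · simp at ha
      · obtain ⟨r, hr, har⟩ := List.mem_flatMap.1 ha
        exact (h.aeval_eq_zero_of_mem_orbit har).2 (hroot r hr)
  have hcard : S.toFinset.card = (poly q).natDegree := by
    rw [List.toFinset_card_of_nodup hnd, hlen]
  have hle := card_roots_le h.isPrimitiveRoot hq.monic.ne_zero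
  have heq : S.toFinset = T := Finset.eq_of_subset_of_card_le hST (hcard ▸ hle)
  refine ⟨?_, fun r hr => ⟨fun h0 => ?_, hroot r⟩⟩
  · -- the greatest common divisor with `X^p - 1` has the same roots, so it has full degree
    set D := EuclideanDomain.gcd (poly q) (X ^ p - 1) with hD
    have hDq : D ∣ poly q := EuclideanDomain.gcd_dvd_left _ _
    have hD0 : D ≠ 0 := ne_zero_of_dvd_ne_zero hq.monic.ne_zero hDq
    have h1 : T.card ≤ D.natDegree := by
      refine le_trans (Finset.card_le_card fun a ha => ?_) (card_roots_le h.isPrimitiveRoot hD0)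
      rw [hT, Finset.mem_filter] at ha
      refine Finset.mem_filter.2 ⟨ha.1, ?_⟩
      exact eval₂_gcd_eq_zero ha.2 (aeval_X_pow_sub_one_pow h.isPrimitiveRoot a)
    rw [← heq, hcard] at h1
    have h2 : Associated D (poly q) := associated_of_dvd_of_natDegree_le hDq hq.monic.ne_zero h1
    exact h2.dvd'.trans (EuclideanDomain.gcd_dvd_right _ _)
  · have hrT : r ∈ T := Finset.mem_filter.2
      ⟨Finset.mem_range.2 (reps_lt p (List.mem_cons_of_mem _ h.1) r hr).2, h0⟩
    rw [← heq, List.mem_toFinset] at hrT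
    rcases List.mem_append.1 hrT with ha | ha
    · have := (reps_lt p (List.mem_cons_of_mem _ h.1) r hr).1
      rw [hZ] at ha
      split_ifs at ha
      · rw [List.mem_singleton.1 ha] at this
        omega
      · simp at ha
    · obtain ⟨r', hr', har⟩ := List.mem_flatMap.1 ha
      rwa [eq_of_mem_orbit p h.1 r hr r' (hsubR.subset hr') har]

/-- The number of non-trivial indecomposable summands with label `r` of the `F_2[X]`-module given
by `M`. For `p = 2` these are the Jordan blocks of size `2`; their number is `n` minus the number
of all Jordan blocks. -/
noncomputable def nu (p : ℕ) (ζ : K) (M : Matrix (Fin n) (Fin n) F2) (r : ℕ) : ℕ :=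
  if p = 2 then n - mult M (1 : K) else mult M (ζ ^ r)

/-- The list `L` contains each label `r` of a non-trivial indecomposable summand as often as the
summand occurs in the module given by `M`. -/
def HasType (p : ℕ) (ζ : K) (M : Matrix (Fin n) (Fin n) F2) (L : List ℕ) : Prop :=
  (∀ r ∈ L, r ∈ reps p) ∧ ∀ r ∈ reps p, L.count r = nu p ζ M r

/-- `p` is one of the primes that occur, and `ζ` is the chosen `p`-th root of unity if `p` is
odd. -/
def IsRootFor (p : ℕ) (ζ : K) : Prop := p = 2 ∨ IsGenRoot p ζ

theorem IsRootFor.mem (h : IsRootFor p ζ) : p ∈ 2 :: oddPrimes :=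
  List.mem_cons.2 (h.imp id And.left)

theorem exists_isRootFor [IsAlgClosed K] (hp : p ∈ 2 :: oddPrimes) : ∃ ζ : K, IsRootFor p ζ := by
  rcases List.mem_cons.1 hp with h | h
  · exact ⟨1, Or.inl h⟩
  · obtain ⟨ζ, hζ⟩ := exists_isGenRoot (K := K) h
    exact ⟨ζ, Or.inr hζ⟩

variable {M : Matrix (Fin n) (Fin n) F2} {A B : GLn n} {L L' : List ℕ}

theorem IsGenRoot.mult_of_mem_orbit (h : IsGenRoot p ζ) (hM : M ^ p = 1) {a r : ℕ}
    (ha : a ∈ orbit p r) : mult M (ζ ^ a) = mult M (ζ ^ r) := by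
  obtain ⟨j, hj⟩ := h.exists_pow_eq ha
  rw [hj, mult_pow_two_pow (prime_of_mem p h.1).2 hM]

theorem exists_hasType (h : IsRootFor p ζ) (M : Matrix (Fin n) (Fin n) F2) :
    ∃ L, HasType p ζ M L := by
  refine ⟨(reps p).flatMap fun r => List.replicate (nu p ζ M r) r, fun r hr => ?_, fun r hr => ?_⟩
  · obtain ⟨r', hr', h1⟩ := List.mem_flatMap.1 hr
    rwa [(List.mem_replicate.1 h1).2]
  · have hnd := reps_nodup p h.mem
    generalize reps p = R at hr hnd
    induction R with
    | nil => simp at hr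
    | cons x R ih =>
      rw [List.nodup_cons] at hnd
      rw [List.flatMap_cons, List.count_append, List.count_replicate]
      rcases List.mem_cons.1 hr with rfl | hr
      · have : r ∉ R.flatMap fun r => List.replicate (nu p ζ M r) r := fun hm => by
          obtain ⟨r', hr', h1⟩ := List.mem_flatMap.1 hm
          exact hnd.1 ((List.mem_replicate.1 h1).2 ▸ hr')
        simp [List.count_eq_zero_of_not_mem this]
      · have hx : x ≠ r := fun hx => hnd.1 (hx ▸ hr)
        simp [hx, ih hr hnd.2]

/-- The trivial summands and the non-trivial ones make up the whole space. -/
theorem IsGenRoot.mult_one_add (h : IsGenRoot p ζ) (hM : M ^ p = 1) (hL : HasType p ζ M L) :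
    mult M (1 : K) + blockDim p * L.length = n := by
  have hp2 := ne_two_of_mem h.1
  have hlen : L.length = ((reps p).map fun r => mult M (ζ ^ r)).sum := by
    have h1 : ∀ r ∈ reps p, mult M (ζ ^ r) = L.count r := fun r hr => by
      rw [hL.2 r hr, nu, if_neg hp2]
    rw [List.map_congr_left h1]
    have hnd := reps_nodup p (List.mem_cons_of_mem _ h.1)
    rw [← List.sum_toFinset _ hnd]
    have h2 := Multiset.sum_count_eq_card (s := (reps p).toFinset) (m := (L : Multiset ℕ))
      fun a ha => List.mem_toFinset.2 (hL.1 a (by simpa using ha))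
    simpa using h2.symm
  refine Eq.trans ?_ (sum_mult (prime_of_mem p h.1).2 h.isPrimitiveRoot hM)
  rw [← List.toFinset_range, List.sum_toFinset _ List.nodup_range,
    ((range_perm_orbits p h.1).map _).sum_eq, List.map_cons, List.sum_cons, pow_zero, hlen]
  congr 1
  generalize reps p = R
  induction R with
  | nil => simp
  | cons r R ih =>
    rw [List.map_cons, List.sum_cons, mul_add, ih, List.flatMap_cons, List.map_append,
      List.sum_append]
    congr 1
    rw [List.map_congr_left fun a ha => h.mult_of_mem_orbit hM ha]
    simp [orbit, Function.comp_def]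

theorem HasType.mult_one_add_two (hM : M ^ 2 = 1) (hL : HasType 2 ζ M L) :
    mult M (1 : K) + L.length = n := by
  have h1 : ∀ r ∈ L, r = 1 := fun r hr => by simpa [reps] using hL.1 r hr
  have h2 := hL.2 1 (by simp [reps])
  rw [List.eq_replicate_of_mem h1, List.count_replicate_self, nu, if_pos rfl] at h2
  have := (mult_two_le (K := K) hM).1
  omega

theorem HasType.mult_one_eq_iff (h : IsRootFor p ζ) {M' : Matrix (Fin n) (Fin n) F2}
    (hM : M ^ p = 1) (hM' : M' ^ p = 1) (hL : HasType p ζ M L) (hL' : HasType p ζ M' L') :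
    mult M (1 : K) = mult M' (1 : K) ↔ L.length = L'.length := by
  rcases h with rfl | h
  · have h1 := hL.mult_one_add_two hM
    have h2 := hL'.mult_one_add_two hM'
    omega
  · have h1 := h.mult_one_add hM hL
    have h2 := h.mult_one_add hM' hL'
    have h3 : 0 < blockDim p := by
      obtain ⟨t, -, -, h3, -⟩ := gen_spec p h.1
      exact h3
    constructor
    · intro h4
      exact Nat.eq_of_mul_eq_mul_left h3 (by omega)
    · intro h4
      rw [h4] at h1
      omega

theorem HasType.blockDim_mul_length_le (h : IsRootFor p ζ) (hM : M ^ p = 1)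
    (hL : HasType p ζ M L) : blockDim p * L.length ≤ n := by
  rcases h with rfl | h
  · have h1 := hL.mult_one_add_two hM
    have h2 := (mult_two_le (K := K) hM).2
    simp only [blockDim]
    omega
  · have := h.mult_one_add hM hL
    omega

theorem HasType.eq_one (h : IsRootFor p ζ) (hM : M ^ p = 1) (hL : HasType p ζ M []) : M = 1 := by
  apply eq_one_of_mult_one (K := K)
  rcases h with rfl | h
  · simpa using hL.mult_one_add_two hM
  · simpa using h.mult_one_add hM hL

theorem HasType.perm (hL : HasType p ζ M L) (hL' : HasType p ζ M L') : L.Perm L' := by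
  rw [List.perm_iff_count]
  intro r
  by_cases hr : r ∈ reps p
  · rw [hL.2 r hr, hL'.2 r hr]
  · rw [List.count_eq_zero_of_not_mem fun h => hr (hL.1 r h),
      List.count_eq_zero_of_not_mem fun h => hr (hL'.1 r h)]

theorem HasType.of_perm (hL : HasType p ζ M L) (h : L.Perm L') : HasType p ζ M L' :=
  ⟨fun r hr => hL.1 r (h.mem_iff.2 hr), fun r hr => by rw [← h.count_eq, hL.2 r hr]⟩

theorem HasType.of_similar (hL : HasType p ζ (A : Matrix (Fin n) (Fin n) F2) L)
    (h : Similar A B) : HasType p ζ (B : Matrix (Fin n) (Fin n) F2) L :=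
  ⟨hL.1, fun r hr => by rw [hL.2 r hr, nu, nu, h.mult_eq, h.mult_eq]⟩

/-- Matrices of the same type are similar: the labels give the multiplicities of all roots of unity
other than `1`, and the multiplicity of `1` follows from the dimension. -/
theorem HasType.similar (h : IsRootFor p ζ) (hA : (A : Matrix (Fin n) (Fin n) F2) ^ p = 1)
    (hB : (B : Matrix (Fin n) (Fin n) F2) ^ p = 1)
    (hLA : HasType p ζ (A : Matrix (Fin n) (Fin n) F2) L)
    (hLB : HasType p ζ (B : Matrix (Fin n) (Fin n) F2) L) : Similar A B := by
  have h1 := (hLA.mult_one_eq_iff h hA hB hLB).2 rfl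
  rcases h with rfl | h
  · exact similar_of_mult_eq_two hA hB h1
  · have hp := prime_of_mem p h.1
    refine similar_of_mult_eq hp.2 h.isPrimitiveRoot hA hB fun a => ?_
    rw [← h.pow_mod]
    have ha := (range_perm_orbits p h.1).mem_iff.1 (List.mem_range.2 (Nat.mod_lt a hp.1.pos))
    rcases List.mem_cons.1 ha with ha | ha
    · rw [ha, pow_zero, h1]
    · obtain ⟨r, hr, har⟩ := List.mem_flatMap.1 ha
      rw [h.mult_of_mem_orbit hA har, h.mult_of_mem_orbit hB har]
      have h2 := (hLA.2 r hr).symm.trans (hLB.2 r hr)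
      rwa [nu, nu, if_neg (ne_two_of_mem h.1), if_neg (ne_two_of_mem h.1)] at h2

theorem IsRootFor.nu_pow (h : IsRootFor p ζ) (hM : M ^ p = 1) {i : ℕ} (hi : i < p) (hi0 : i ≠ 0)
    (r : ℕ) : nu p ζ (M ^ i) (rep p (i * r % p)) = nu p ζ M r := by
  rcases h with rfl | h
  · obtain rfl : i = 1 := by omega
    simp [nu]
  · have hp := prime_of_mem p h.1
    have hMi : (M ^ i) ^ p = 1 := by rw [← pow_mul, mul_comm, pow_mul, hM, one_pow]
    have hc : (ζ ^ r) ^ p = 1 := by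
      rw [← pow_mul, mul_comm, pow_mul, h.isPrimitiveRoot.pow_eq_one, one_pow]
    rw [nu, nu, if_neg (ne_two_of_mem h.1), if_neg (ne_two_of_mem h.1),
      h.mult_of_mem_orbit hMi (rep_mem_orbit p h.1 _ (Nat.mod_lt _ hp.1.pos)), h.pow_mod, mul_comm,
      pow_mul, mult_pow hM hc]
    exact (Nat.coprime_of_lt_prime hi0 hi hp.1).symm

/-- Powers of matrices act on types through the Galois group. -/
theorem HasType.pow (h : IsRootFor p ζ) (hM : M ^ p = 1) (hL : HasType p ζ M L) {i : ℕ}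
    (hi : i < p) (hi0 : i ≠ 0) : HasType p ζ (M ^ i) (act p i L) := by
  have hperm := act_reps_perm p h.mem i hi hi0
  refine ⟨fun r hr => ?_, fun r hr => ?_⟩
  · obtain ⟨r', hr', rfl⟩ := List.mem_map.1 hr
    exact hperm.mem_iff.1 (List.mem_map_of_mem (hL.1 r' hr'))
  · obtain ⟨r', hr', rfl⟩ := List.mem_map.1 (hperm.mem_iff.2 hr)
    rw [h.nu_pow hM hi hi0, ← hL.2 r' hr', act, List.count, List.count, List.countP_map]
    refine List.countP_congr fun x hx => ?_
    have hinj := List.inj_on_of_nodup_map (hperm.nodup_iff.2 (reps_nodup p h.mem)) (hL.1 x hx) hr'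
    simp only [Function.comp_apply, beq_iff_eq]
    exact ⟨hinj, fun h => h ▸ rfl⟩

theorem card_subtype_get {α : Type*} (l : List α) (P : α → Prop) [DecidablePred P] :
    Nat.card {k : Fin l.length // P (l.get k)} = l.countP (P ·) := by
  rw [Nat.card_eq_fintype_card, Fintype.card_subtype, Finset.card_filter]
  have := Fin.sum_univ_fun_getElem l fun x => if P x then 1 else 0
  simp only [List.get_eq_getElem]
  rw [this]
  clear this
  induction l with
  | nil => simp
  | cons x l ih => by_cases hx : P x <;> simp [ih, hx, add_comm]

theorem sum_natDegree_get (l : List F2[X]) :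
    ∑ k : Fin l.length, (l.get k).natDegree = (l.map natDegree).sum :=
  Fin.sum_univ_fun_getElem l natDegree

theorem PolyCheck.poly_dvd (h : IsRootFor p ζ) {q : List ℕ} (hq : PolyCheck p q) :
    poly q ∣ X ^ p - 1 := by
  rcases h with rfl | h
  · have h2 : (X ^ 2 - 1 : F2[X]) = (X - 1) ^ 2 := by rw [sub_pow_char, one_pow]
    have h3 : (X - 1 : F2[X]) = X + 1 := by rw [sub_eq_add_neg, ZModModule.neg_eq_self]
    have h4 : (X ^ 2 - 1 : F2[X]) = X ^ 2 + 1 := by rw [sub_eq_add_neg, ZModModule.neg_eq_self]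
    rcases (if_pos rfl).mp hq.2.2 with rfl | rfl
    · rw [h2, h3]
      simp [poly]
    · rw [h4]
      simp [poly]
  · exact (h.poly_spec hq).1

/-- The type of a direct sum of companion matrices can be read off the polynomials. -/
theorem IsCompSum.hasType (h : IsRootFor p ζ) {e : List (List ℕ)}
    (hM : IsCompSum M (e.map poly)) (he : ∀ q ∈ e, PolyCheck p q) :
    M ^ p = 1 ∧ HasType p ζ M (blockType p e) := by
  classical
  have hmon : ∀ q ∈ e.map poly, q.Monic := fun q hq => by
    obtain ⟨x, hx, rfl⟩ := List.mem_map.1 hq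
    exact (he x hx).monic
  have hd := hM.decomp hmon
  have hMp : M ^ p = 1 := by
    have h1 := hd.aeval_eq_zero (q := X ^ p - 1) fun i => by
      obtain ⟨x, hx, hx'⟩ := List.mem_map.1 (List.get_mem (e.map poly) i)
      rw [← hx']
      exact (he x hx).poly_dvd h
    simpa [sub_eq_zero] using h1
  have hmult (c : K) : mult M c = e.countP fun q => aeval c (poly q) = 0 := by
    rw [hd.mult_eq, card_subtype_get (e.map poly) (fun q => aeval c q = 0), List.countP_map]
    rfl
  refine ⟨hMp, fun r hr => ?_, fun r hr => ?_⟩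
  · obtain ⟨q, hq, hr⟩ := List.mem_flatMap.1 hr
    rw [rootReps] at hr
    split_ifs at hr with h1 h2
    · rw [h1, List.mem_singleton.1 hr]
      simp [reps]
    · simp at hr
    · exact (List.mem_filter.1 hr).1
  · rcases h with rfl | h
    · obtain rfl : r = 1 := by simpa [reps] using hr
      have hn := hM.choose
      rw [sum_natDegree_get, List.map_map] at hn
      rw [nu, if_pos rfl, hmult]
      suffices (e.map (natDegree ∘ poly)).sum
          = (e.countP fun q => aeval (1 : K) (poly q) = 0) + (blockType 2 e).count 1 by omega
      clear hn hmult hMp hd hmon hM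
      induction e with
      | nil => simp [blockType]
      | cons q e ih =>
        have h1 := ih fun x hx => he x (List.mem_cons_of_mem _ hx)
        have h2 := he q List.mem_cons_self
        have h3 : blockType 2 (q :: e) = rootReps 2 q ++ blockType 2 e := rfl
        rw [List.map_cons, List.sum_cons, h1, h3, List.count_append, List.countP_cons,
          Function.comp_apply, h2.natDegree]
        simp only [aeval_one_poly_eq_zero, rootReps]
        rcases (if_pos rfl).mp h2.2.2 with rfl | rfl <;> simp <;> omega
    · rw [nu, if_neg (ne_two_of_mem h.1), hmult]
      clear hmult hMp hd hmon hM
      induction e with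
      | nil => simp [blockType]
      | cons q e ih =>
        have h1 := ih fun x hx => he x (List.mem_cons_of_mem _ hx)
        have h2 := (h.poly_spec (he q List.mem_cons_self)).2 r hr
        have h3 : blockType p (q :: e) = rootReps p q ++ blockType p e := rfl
        have h4 : (rootReps p q).Nodup := by
          rw [rootReps, if_neg (ne_two_of_mem h.1)]
          exact (reps_nodup p (List.mem_cons_of_mem _ h.1)).filter _
        rw [h3, List.count_append, h1, List.countP_cons, h4.count, add_comm]
        simp only [h2, decide_eq_true_eq]

end Types

/-! ### The types of the listed pairs -/

section TableData

/-- The order and the types of `B` and `A` for each listed pair `(B, A)`. -/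
def types : ℕ → List (ℕ × List ℕ × List ℕ)
  | 6 => [(31, [1], [5]), (31, [1], [15]), (31, [1], [3]), (31, [1], [1]), (7, [1, 3], [1, 3]),
      (5, [1], [1]), (7, [1], [3]), (7, [1], [1]), (3, [1, 1], [1, 1]), (7, [3, 3], [1, 3]),
      (7, [3, 3], [1, 1]), (7, [3, 3], [3, 3]), (3, [1], [1]), (2, [1, 1, 1], [1, 1, 1]),
      (3, [1, 1, 1], [1, 1, 1]), (2, [1, 1], [1, 1]), (2, [1], [1])]
  | 7 => [(7, [1, 3], [1, 3]), (127, [1], [7]), (127, [1], [19]), (127, [1], [63]), (127, [1], [9]),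
      (127, [1], [31]), (127, [1], [5]), (127, [1], [29]), (127, [1], [43]), (127, [1], [11]),
      (127, [1], [1]), (31, [1], [5]), (31, [1], [15]), (31, [1], [3]), (31, [1], [1]),
      (5, [1], [1]), (7, [1, 1], [1, 3]), (7, [1, 1], [3, 3]), (7, [1, 1], [1, 1]), (7, [1], [3]),
      (7, [1], [1]), (3, [1, 1], [1, 1]), (3, [1, 1, 1], [1, 1, 1]), (3, [1], [1]),
      (2, [1, 1, 1], [1, 1, 1]), (2, [1, 1], [1, 1]), (2, [1], [1])]
  | 8 => [(17, [1], [3]), (17, [1], [1]), (127, [19], [3]), (127, [19], [31]), (127, [19], [27]),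
      (127, [19], [7]), (127, [19], [13]), (127, [19], [15]), (127, [19], [63]), (127, [19], [23]),
      (127, [19], [47]), (127, [19], [19]), (7, [1, 3], [1, 3]), (31, [1], [5]), (31, [1], [15]),
      (31, [1], [3]), (31, [1], [1]), (5, [1], [1]), (7, [1, 1], [1, 3]), (7, [1, 1], [3, 3]),
      (7, [1, 1], [1, 1]), (5, [1, 1], [1, 1]), (7, [1], [3]), (7, [1], [1]),
      (3, [1, 1, 1], [1, 1, 1]), (3, [1, 1], [1, 1]), (3, [1], [1]),
      (2, [1, 1, 1, 1], [1, 1, 1, 1]), (3, [1, 1, 1, 1], [1, 1, 1, 1]), (2, [1, 1, 1], [1, 1, 1]),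
      (2, [1, 1], [1, 1]), (2, [1], [1])]
  | _ => []

/-- The listed pairs together with their orders and types. -/
def typedTable (n : ℕ) : List ((List (List ℕ) × List (List ℕ)) × ℕ × List ℕ × List ℕ) :=
  (table n).zip (types n)

/-- A list of polynomials in which divisibility of neighbours has a simple reason. -/
def ChainCheck (e : List (List ℕ)) : Prop :=
  e.IsChain fun r q => r = q ∨ (r = [1, 0] ∧ q.length % 2 = 0) ∨
    (r = [3, 1, 0] ∧ q = [4, 3, 2, 0]) ∨ (r = [3, 2, 0] ∧ q = [4, 2, 1, 0]) ∨
    (r = [2, 1, 0] ∧ q = [3, 0])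

instance (e : List (List ℕ)) : Decidable (ChainCheck e) := by unfold ChainCheck; infer_instance

/-- The polynomials in `e` have total degree `n`, divide `X^p - 1`, form a divisibility chain, and
their companion matrices have a direct sum of the non-trivial type `L`. -/
def FormCheck (n p : ℕ) (e : List (List ℕ)) (L : List ℕ) : Prop :=
  (e.map fun q => q.headD 0).sum = n ∧ (∀ q ∈ e, PolyCheck p q) ∧ blockType p e = L ∧ L ≠ [] ∧
    ChainCheck e

instance (n p : ℕ) (e : List (List ℕ)) (L : List ℕ) : Decidable (FormCheck n p e L) := by
  unfold FormCheck; infer_instance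

theorem formCheck_typedTable : ∀ n ∈ [6, 7, 8], ∀ x ∈ typedTable n, x.2.1 ∈ 2 :: oddPrimes ∧
    FormCheck n x.2.1 x.1.1 x.2.2.1 ∧ FormCheck n x.2.1 x.1.2 x.2.2.2 := by decide +kernel

theorem map_fst_typedTable : ∀ n ∈ [6, 7, 8], (typedTable n).map Prod.fst = table n := by
  decide +kernel

theorem nodup_typedTable : ∀ n ∈ [6, 7, 8], (typedTable n).Nodup := by decide +kernel

/-- The combinatorial form of power-similarity: the power `i` turns the pair of types `t` into
`s`. -/
def Related (p i : ℕ) (s t : List ℕ × List ℕ) : Prop :=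
  s.1.Perm (act p i t.1) ∧ s.2.Perm (act p i t.2)

instance (p i : ℕ) (s t : List ℕ × List ℕ) : Decidable (Related p i s t) := by
  unfold Related; infer_instance

theorem pairwise_typedTable : ∀ n ∈ [6, 7, 8], (typedTable n).Pairwise fun x y => x.2.1 = y.2.1 →
    ∀ i ∈ reps x.2.1, (¬ Related x.2.1 i x.2.2 y.2.2 ∧ ¬ Related x.2.1 i x.2.2 y.2.2.swap) ∧
      (¬ Related x.2.1 i y.2.2 x.2.2 ∧ ¬ Related x.2.1 i y.2.2 x.2.2.swap) := by decide +kernel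

/-- All lists of `m` elements of `R`. -/
def tuples (R : List ℕ) : ℕ → List (List ℕ)
  | 0 => [[]]
  | m + 1 => R.flatMap fun r => (tuples R m).map (r :: ·)

theorem mem_tuples {R L : List ℕ} (h : ∀ r ∈ L, r ∈ R) : L ∈ tuples R L.length := by
  induction L with
  | nil => simp [tuples]
  | cons r L ih =>
    exact List.mem_flatMap.2 ⟨r, h r List.mem_cons_self,
      List.mem_map_of_mem (ih fun x hx => h x (List.mem_cons_of_mem _ hx))⟩

/-- The primes that divide the order of `GL(n, F_2)`. -/
def primesOf : ℕ → List ℕ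
  | 6 => [2, 3, 5, 7, 31] | 7 => [2, 3, 5, 7, 31, 127] | 8 => [2, 3, 5, 7, 17, 31, 127] | _ => []

theorem primesOf_subset : ∀ n ∈ [6, 7, 8], ∀ p ∈ primesOf n, p ∈ 2 :: oddPrimes := by decide

/-- The quotient of the first element of `L` by `y` modulo the prime `p`. -/
def quot (p : ℕ) (L : List ℕ) (y : ℕ) : ℕ := L.headD 0 * y ^ (p - 2) % p

/-- Every pair of types of equal length occurs in the table, up to a power and a swap. If the power
`i` turns a list containing `y` into one with first element `x`, then `i` may be taken to be `x / y`
for a suitable `y`, so only these powers are tried. -/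
theorem exists_related : ∀ n ∈ [6, 7, 8], ∀ p ∈ primesOf n, ∀ m ≤ n / blockDim p, m ≠ 0 →
    ∀ LB ∈ tuples (reps p) m, ∀ LA ∈ tuples (reps p) m, ∃ x ∈ typedTable n, x.2.1 = p ∧
      ((∃ y ∈ x.2.2.1, quot p LB y ≠ 0 ∧ Related p (quot p LB y) (LB, LA) x.2.2) ∨
        ∃ y ∈ x.2.2.2, quot p LB y ≠ 0 ∧ Related p (quot p LB y) (LB, LA) x.2.2.swap) := by
  decide +kernel

theorem mem_primesOf_of_dvd : ∀ n ∈ [6, 7, 8], ∀ i < n, ∀ q < 256, q ∣ 2 ^ n - 2 ^ i → q.Prime →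
    q ∈ primesOf n := by decide +kernel

theorem one_mem_reps : ∀ p ∈ 2 :: oddPrimes, 1 ∈ reps p := by decide

end TableData

/-! ### Similarity and power-similarity -/

section Similarity

variable {n p : ℕ}

theorem Similar.refl (A : GLn n) : Similar A A := ⟨1, by simp⟩

theorem Similar.pow {A B : GLn n} (h : Similar A B) (i : ℕ) : Similar (A ^ i) (B ^ i) := by
  obtain ⟨P, rfl⟩ := h
  refine ⟨P, ?_⟩
  have := conj_pow (i := i) (a := P⁻¹) (b := A)
  rwa [inv_inv] at this

theorem Similar.inv {A B : GLn n} (h : Similar A B) : Similar A⁻¹ B⁻¹ := by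
  obtain ⟨P, rfl⟩ := h
  exact ⟨P, by group⟩

theorem Similar.eq_one {A : GLn n} (h : Similar A 1) : A = 1 := by
  obtain ⟨P, hP⟩ := h
  rw [eq_comm, mul_eq_one_iff_eq_inv, mul_eq_left] at hP
  exact hP

theorem inv_pow_eq {G : Type*} [Group G] {C : G} (hp : 0 < p) (hC : C ^ p = 1) (i : ℕ) :
    (C ^ i)⁻¹ = C ^ (i * (p - 1)) := by
  rw [inv_eq_iff_mul_eq_one, ← pow_add]
  obtain ⟨k, rfl⟩ := Nat.exists_eq_add_of_lt hp
  have : i + i * (0 + k + 1 - 1) = (0 + k + 1) * i := by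
    rw [Nat.add_sub_cancel]; ring
  rw [this, pow_mul, hC, one_pow]

theorem PowerSimilar.of_inv {s t : GLn n × GLn n} (hp : 1 < p) (h1 : t.1 ^ p = 1)
    (h2 : t.2 ^ p = 1) (h : PowerSimilar (s.1⁻¹, s.2⁻¹) t) : PowerSimilar s t := by
  obtain ⟨i, hi, h3, h4⟩ := h
  refine ⟨i * (p - 1), Nat.mul_pos hi (by omega), ?_, ?_⟩
  · rw [← inv_pow_eq (by omega) h1]
    simpa using h3.inv
  · rw [← inv_pow_eq (by omega) h2]
    simpa using h4.inv

/-- For matrices whose order divides `p`, inverting one of the pairs does not matter, so that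
extended power-similarity is power-similarity up to a swap. -/
theorem extPowerSimilar_iff {s t : GLn n × GLn n} (hp : 1 < p) (h1 : t.1 ^ p = 1)
    (h2 : t.2 ^ p = 1) : ExtPowerSimilar s t ↔ PowerSimilar s t ∨ PowerSimilar s t.swap := by
  refine or_congr Iff.rfl ⟨fun h => h.of_inv hp h2 h1, fun h => ?_⟩
  refine PowerSimilar.of_inv (t := t.swap) hp h2 h1 ?_
  simpa only [inv_inv] using h

theorem PowerSimilar.swap {s t : GLn n × GLn n} (h : PowerSimilar s t) :
    PowerSimilar s.swap t.swap := by
  obtain ⟨i, hi, h1, h2⟩ := h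
  exact ⟨i, hi, h2, h1⟩

end Similarity

/-! ### Types of pairs -/

section PairTypes

variable {K : Type*} [Field K] [Algebra F2 K] {p n : ℕ} {ζ : K}

/-- Both matrices of the pair `s` have order `p`, and their types are the ones in `L`. -/
structure PairType (p : ℕ) (ζ : K) (s : GLn n × GLn n) (L : List ℕ × List ℕ) : Prop where
  orderOf_fst : orderOf s.1 = p
  orderOf_snd : orderOf s.2 = p
  hasType_fst : HasType p ζ (s.1 : Matrix (Fin n) (Fin n) F2) L.1
  hasType_snd : HasType p ζ (s.2 : Matrix (Fin n) (Fin n) F2) L.2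

variable {s t : GLn n × GLn n} {L L' : List ℕ × List ℕ}

theorem coe_pow_eq_one {A : GLn n} (h : orderOf A = p) :
    (A : Matrix (Fin n) (Fin n) F2) ^ p = 1 := by
  rw [← Units.val_pow_eq_pow_val, ← h, pow_orderOf_eq_one, Units.val_one]

theorem IsRootFor.prime (h : IsRootFor p ζ) : p.Prime := by
  rcases h with rfl | h
  · exact Nat.prime_two
  · exact (prime_of_mem p h.1).1

theorem PairType.swap (h : PairType p ζ s L) : PairType p ζ s.swap L.swap :=
  ⟨h.2, h.1, h.4, h.3⟩

theorem PairType.powerSimilar (hζ : IsRootFor p ζ) (h : PairType p ζ s L) (h' : PairType p ζ t L')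
    {i : ℕ} (hi : i < p) (hi0 : i ≠ 0) (hr : Related p i L L') : PowerSimilar s t := by
  have key {A B : GLn n} {l l' : List ℕ} (hA : orderOf A = p) (hB : orderOf B = p)
      (hl : HasType p ζ (A : Matrix (Fin n) (Fin n) F2) l)
      (hl' : HasType p ζ (B : Matrix (Fin n) (Fin n) F2) l') (hll : l.Perm (act p i l')) :
      Similar A (B ^ i) := by
    refine HasType.similar hζ (coe_pow_eq_one hA) ?_ (hl.of_perm hll) ?_
    · rw [Units.val_pow_eq_pow_val, ← pow_mul, mul_comm, pow_mul, coe_pow_eq_one hB, one_pow]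
    · rw [Units.val_pow_eq_pow_val]
      exact hl'.pow hζ (coe_pow_eq_one hB) hi hi0
  exact ⟨i, Nat.pos_of_ne_zero hi0, key h.1 h'.1 h.3 h'.3 hr.1, key h.2 h'.2 h.4 h'.4 hr.2⟩

theorem PairType.exists_related (hζ : IsRootFor p ζ) (h : PairType p ζ s L)
    (h' : PairType p ζ t L') (hs : PowerSimilar s t) : ∃ i < p, i ≠ 0 ∧ Related p i L L' := by
  obtain ⟨j, -, h1, h2⟩ := hs
  have hp := hζ.prime
  have hj1 : t.1 ^ j = t.1 ^ (j % p) := by rw [← h'.1, pow_mod_orderOf]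
  have hj2 : t.2 ^ j = t.2 ^ (j % p) := by rw [← h'.2, pow_mod_orderOf]
  rw [hj1] at h1
  rw [hj2] at h2
  have hlt := Nat.mod_lt j hp.pos
  have hne : j % p ≠ 0 := fun h0 => by
    rw [h0, pow_zero] at h1
    have := h.1
    rw [h1.eq_one, orderOf_one] at this
    exact hp.one_lt.ne this
  refine ⟨j % p, hlt, hne, ?_, ?_⟩
  · have h3 := h.3.of_similar h1
    rw [Units.val_pow_eq_pow_val] at h3
    exact h3.perm (h'.3.pow hζ (coe_pow_eq_one h'.1) hlt hne)
  · have h3 := h.4.of_similar h2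
    rw [Units.val_pow_eq_pow_val] at h3
    exact h3.perm (h'.4.pow hζ (coe_pow_eq_one h'.2) hlt hne)

theorem rep_mul_two_pow (hp : p ∈ oddPrimes) (c j : ℕ) : rep p (c * 2 ^ j % p) = rep p (c % p) := by
  induction j with
  | zero => simp
  | succ j ih =>
    have h1 : c * 2 ^ (j + 1) % p = 2 * (c * 2 ^ j % p) % p := by
      rw [Nat.mul_mod_mod]; congr 1; ring
    rw [h1, rep_two_mul p hp _ (Nat.mod_lt _ (prime_of_mem p hp).1.pos), ih]

/-- The action of `i` on types depends on the orbit of `i` only, as matrices are similar to their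
Frobenius powers. -/
theorem exists_rep_act (hp : p ∈ 2 :: oddPrimes) {i : ℕ} (hi : i < p) (hi0 : i ≠ 0) :
    ∃ r ∈ reps p, ∀ l, act p r l = act p i l := by
  rcases List.mem_cons.1 hp with rfl | hp'
  · obtain rfl : i = 1 := by omega
    exact ⟨1, by simp [reps], fun _ => rfl⟩
  · refine ⟨rep p i, ?_, fun l => ?_⟩
    · rw [← (act_reps_perm p hp i hi hi0).mem_iff]
      refine List.mem_map.2 ⟨1, one_mem_reps p hp, ?_⟩
      rw [mul_one, Nat.mod_eq_of_lt hi]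
    · obtain ⟨j, -, hj⟩ := List.mem_map.1 (rep_mem_orbit p hp' i hi)
      refine List.map_congr_left fun x _ => ?_
      rw [← hj, Nat.mod_mul_mod, mul_right_comm, rep_mul_two_pow hp']

theorem mult_matrix_one : mult (1 : Matrix (Fin n) (Fin n) F2) (1 : K) = n := by
  have h1 := card_fixed (K := K) (1 : Matrix (Fin n) (Fin n) F2)
  have h2 : Nat.card {v : V n // (1 : Matrix (Fin n) (Fin n) F2).mulVec v = v} = 2 ^ n := by
    rw [Nat.card_congr (Equiv.subtypeUnivEquiv fun v => Matrix.one_mulVec v)]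
    simp
  exact Nat.pow_right_injective le_rfl (h1.symm.trans h2)

theorem HasType.eq_nil (hζ : IsRootFor p ζ) {l : List ℕ}
    (h : HasType p ζ (1 : Matrix (Fin n) (Fin n) F2) l) : l = [] := by
  rw [← List.length_eq_zero_iff]
  rcases hζ with rfl | hζ
  · have := h.mult_one_add_two (one_pow 2)
    rw [mult_matrix_one] at this
    omega
  · have := hζ.mult_one_add (one_pow p) h
    rw [mult_matrix_one] at this
    obtain ⟨t, -, -, h3, -⟩ := gen_spec p hζ.1
    have h4 : blockDim p * l.length = 0 := by omega
    exact (Nat.mul_eq_zero.1 h4).resolve_left h3.ne'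

end PairTypes

/-! ### The matrices of the table -/

section Tables

variable {K : Type*} [Field K] [Algebra F2 K] {p n : ℕ} {ζ : K} {e : List (List ℕ)} {l : List ℕ}

theorem FormCheck.exists_isMatrixOf (hζ : IsRootFor p ζ) (h : FormCheck n p e l) :
    ∃ M : GLn n, IsMatrixOf M e := by
  have hn : ∑ k : Fin (e.map poly).length, ((e.map poly).get k).natDegree = n := by
    rw [sum_natDegree_get, List.map_map, ← h.1]
    exact congrArg List.sum (List.map_congr_left fun q hq => (h.2.1 q hq).natDegree)
  have hM : IsCompSum (Matrix.reindex (finCongr hn) (finCongr hn) (compSum (e.map poly)))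
    (e.map poly) := ⟨hn, rfl⟩
  exact ⟨Units.ofPowEqOne _ p (hM.hasType hζ h.2.1).1 hζ.prime.ne_zero, hM⟩

theorem IsMatrixOf.unique {M M' : GLn n} (h : IsMatrixOf M e) (h' : IsMatrixOf M' e) : M = M' := by
  obtain ⟨h1, h2⟩ := h
  obtain ⟨h3, h4⟩ := h'
  exact Units.ext (h2.trans h4.symm)

theorem FormCheck.hasType (hζ : IsRootFor p ζ) (h : FormCheck n p e l) {M : GLn n}
    (hM : IsMatrixOf M e) : orderOf M = p ∧ HasType p ζ (M : Matrix (Fin n) (Fin n) F2) l := by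
  obtain ⟨h1, h2⟩ := IsCompSum.hasType hζ hM h.2.1
  rw [h.2.2.1] at h2
  have := Fact.mk hζ.prime
  refine ⟨orderOf_eq_prime (Units.ext ?_) fun h3 => h.2.2.2.1 ?_, h2⟩
  · rw [Units.val_pow_eq_pow_val, h1, Units.val_one]
  · rw [h3] at h2
    exact h2.eq_nil hζ

theorem poly_dvd_of_chainCheck {r q : List ℕ}
    (h : r = q ∨ (r = [1, 0] ∧ q.length % 2 = 0) ∨ (r = [3, 1, 0] ∧ q = [4, 3, 2, 0]) ∨
      (r = [3, 2, 0] ∧ q = [4, 2, 1, 0]) ∨ (r = [2, 1, 0] ∧ q = [3, 0])) : poly r ∣ poly q := by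
  have h2 : (2 : F2[X]) = 0 := CharTwo.two_eq_zero
  rcases h with rfl | ⟨rfl, h⟩ | ⟨rfl, rfl⟩ | ⟨rfl, rfl⟩ | ⟨rfl, rfl⟩
  · exact dvd_rfl
  · have h3 : poly [1, 0] = X - C 1 := by
      rw [sub_eq_add_neg, ZModModule.neg_eq_self]
      simp [poly]
    rw [h3, dvd_iff_isRoot, IsRoot, ← coe_aeval_eq_eval]
    exact (aeval_one_poly_eq_zero q).2 h
  · refine ⟨X + 1, ?_⟩
    simp only [poly, List.map_cons, List.map_nil, List.sum_cons, List.sum_nil]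
    linear_combination (-X) * h2
  · refine ⟨X + 1, ?_⟩
    simp only [poly, List.map_cons, List.map_nil, List.sum_cons, List.sum_nil]
    linear_combination (-X ^ 3) * h2
  · refine ⟨X + 1, ?_⟩
    simp only [poly, List.map_cons, List.map_nil, List.sum_cons, List.sum_nil]
    linear_combination (-X ^ 2 - X) * h2

theorem FormCheck.isRCF (h : FormCheck n p e l) {M : GLn n} (hM : IsMatrixOf M e) : IsRCF M := by
  refine ⟨e.map poly, fun q hq => ?_, ?_, hM⟩
  · obtain ⟨x, hx, rfl⟩ := List.mem_map.1 hq
    have hx' := h.2.1 x hx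
    exact ⟨hx'.monic, hx'.natDegree ▸ hx'.2.1⟩
  · rw [List.isChain_map]
    exact h.2.2.2.2.imp fun _ _ => poly_dvd_of_chainCheck

end Tables

/-! ### Linear automorphisms of permutations -/

section Automorphisms

variable {n p : ℕ}

theorem blockDiag_mem_AutLE {A B : GLn n} {F : V n → V n} :
    blockDiag (A, B) ∈ AutLE F ↔ ∀ x, F (linPerm A x) = linPerm B (F x) := by
  have hbd (x y : V n) : blockDiag (A, B) (x, y) = (linPerm A x, linPerm B y) := rfl
  have hmem : blockDiag (A, B) ∈ AutLE F ↔ graph F = blockDiag (A, B) '' graph F :=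
    ⟨fun h => h.1, fun h => ⟨h, (A, B), rfl⟩⟩
  rw [hmem]
  constructor
  · intro h x
    have h1 : blockDiag (A, B) (x, F x) ∈ graph F := by
      rw [h]
      exact ⟨_, rfl, rfl⟩
    exact (h1 : linPerm B (F x) = F (linPerm A x)).symm
  · intro h
    ext ⟨x, y⟩
    constructor
    · intro hxy
      refine ⟨((linPerm A).symm x, F ((linPerm A).symm x)), rfl, ?_⟩
      have hy : y = F x := hxy
      rw [hbd, ← h, LinearEquiv.apply_symm_apply, hy]
    · rintro ⟨⟨x', y'⟩, h1, h2⟩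
      have hy : y' = F x' := h1
      rw [hy, hbd, ← h, Prod.mk.injEq] at h2
      change y = F x
      rw [← h2.1, ← h2.2]

theorem linPerm_mul (A B : GLn n) (x : V n) : linPerm (A * B) x = linPerm A (linPerm B x) := by
  simp [linPerm_apply]

theorem linPerm_one (x : V n) : linPerm (1 : GLn n) x = x := by simp [linPerm_apply]

theorem linPerm_injective {A B : GLn n} (h : ∀ x, linPerm A x = linPerm B x) : A = B :=
  Units.ext (Matrix.mulVec_injective (funext h))

theorem AutLE_pow {A B : GLn n} {F : V n → V n} (h : blockDiag (A, B) ∈ AutLE F) (i : ℕ) :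
    blockDiag (A ^ i, B ^ i) ∈ AutLE F := by
  have : blockDiag (A ^ i, B ^ i) = blockDiag (A, B) ^ i := by rw [← map_pow]; rfl
  rw [this]
  exact pow_mem h i

theorem AutLE_inv {A B : GLn n} {F : Equiv.Perm (V n)} (h : blockDiag (A, B) ∈ AutLE F) :
    blockDiag (B, A) ∈ AutLE (F⁻¹ : Equiv.Perm (V n)) := by
  rw [blockDiag_mem_AutLE] at h ⊢
  intro x
  have hx : F (F⁻¹ x) = x := F.apply_symm_apply x
  rw [Equiv.Perm.inv_eq_iff_eq, h, hx]

theorem eq_one_iff_of_mem_AutLE {A B : GLn n} {F : Equiv.Perm (V n)}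
    (h : blockDiag (A, B) ∈ AutLE F) : A = 1 ↔ B = 1 := by
  rw [blockDiag_mem_AutLE] at h
  constructor
  · rintro rfl
    refine linPerm_injective fun x => ?_
    obtain ⟨y, rfl⟩ := F.surjective x
    rw [← h, linPerm_one, linPerm_one]
  · rintro rfl
    refine linPerm_injective fun x => F.injective ?_
    rw [h, linPerm_one, linPerm_one]

/-- `F` maps the fixed vectors of `A` onto those of `B`. -/
theorem mult_one_eq_of_mem_AutLE {K : Type*} [Field K] [Algebra F2 K] {A B : GLn n}
    {F : Equiv.Perm (V n)} (h : blockDiag (A, B) ∈ AutLE F) :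
    mult (A : Matrix (Fin n) (Fin n) F2) (1 : K) = mult (B : Matrix (Fin n) (Fin n) F2) (1 : K) := by
  rw [blockDiag_mem_AutLE] at h
  apply Nat.pow_right_injective le_rfl
  change 2 ^ _ = 2 ^ _
  rw [← card_fixed, ← card_fixed]
  refine Nat.card_congr (F.subtypeEquiv fun v => ?_)
  rw [← linPerm_apply, ← linPerm_apply, ← h, F.injective.eq_iff]

/-- A power of a non-trivial pair `(A, B)` has prime order, and then both components do, since one
is trivial only if the other is. -/
theorem exists_prime_of_nontrivial {F : Equiv.Perm (V n)} (h : Nontrivial (AutLE F)) :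
    ∃ (p : ℕ) (A B : GLn n), p.Prime ∧ orderOf A = p ∧ orderOf B = p ∧
      blockDiag (A, B) ∈ AutLE F := by
  obtain ⟨⟨σ, hσ⟩, hne⟩ := exists_ne (1 : AutLE F)
  obtain ⟨s, rfl⟩ := hσ.2
  have hs : s ≠ 1 := by
    rintro rfl
    exact hne (Subtype.ext (map_one _))
  have hm : orderOf s ≠ 1 := by rwa [Ne, orderOf_eq_one_iff]
  obtain ⟨p, hp, hdvd⟩ := Nat.exists_prime_and_dvd hm
  have hord : orderOf (s ^ (orderOf s / p)) = p :=
    orderOf_pow_orderOf_div (orderOf_pos s).ne' hdvd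
  set k := orderOf s / p
  have hmem : blockDiag (s.1 ^ k, s.2 ^ k) ∈ AutLE F := AutLE_pow hσ k
  have h1 : s.1 ^ k ≠ 1 := fun h1 => by
    have h2 := (eq_one_iff_of_mem_AutLE hmem).1 h1
    have : s ^ k = 1 := Prod.ext h1 h2
    rw [this, orderOf_one] at hord
    exact hp.one_lt.ne hord
  have h2 : s.2 ^ k ≠ 1 := fun h2 => h1 ((eq_one_iff_of_mem_AutLE hmem).2 h2)
  have h3 : (s ^ k) ^ p = 1 := hord ▸ pow_orderOf_eq_one _
  have := Fact.mk hp
  exact ⟨p, _, _, hp, orderOf_eq_prime (congrArg Prod.fst h3) h1,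
    orderOf_eq_prime (congrArg Prod.snd h3) h2, hmem⟩

/-- Conjugating a function by the matrices that realise a power-similarity. -/
theorem exists_linearEquivalent {A B C D : GLn n} {F : Equiv.Perm (V n)} (hp : p.Prime)
    (hB : orderOf B = p) (hC : C ^ p = 1) (hD : D ^ p = 1) (h : blockDiag (A, B) ∈ AutLE F)
    (hs : PowerSimilar (B, A) (C, D)) :
    ∃ G : Equiv.Perm (V n), LinearEquivalent G F ∧ blockDiag (D, C) ∈ AutLE G := by
  obtain ⟨i, -, h1, h2⟩ := hs
  have hi : i.Coprime p := by
    rw [Nat.coprime_comm, hp.coprime_iff_not_dvd]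
    rintro ⟨k, rfl⟩
    simp only at h1
    rw [pow_mul, hC, one_pow] at h1
    rw [h1.eq_one, orderOf_one] at hB
    exact hp.one_lt.ne hB
  obtain ⟨j, -, hj⟩ := Nat.exists_mul_mod_eq_one_of_coprime hi hp.one_lt
  have hpow {E : GLn n} (hE : E ^ p = 1) : (E ^ i) ^ j = E := by
    rw [← pow_mul, ← Nat.div_add_mod (i * j) p, hj, pow_add, pow_mul, hE, one_pow, one_mul, pow_one]
  have h3 := h1.pow j
  have h4 := h2.pow j
  simp only [hpow hC] at h3
  simp only [hpow hD] at h4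
  obtain ⟨P, hP⟩ := h3
  obtain ⟨Q, hQ⟩ := h4
  have hF := blockDiag_mem_AutLE.1 (AutLE_pow h j)
  refine ⟨((linPerm Q).toEquiv.trans F).trans (linPerm P⁻¹).toEquiv, ⟨Q, P, ?_⟩, ?_⟩
  · funext x
    change F (linPerm Q x) = linPerm P (linPerm P⁻¹ (F (linPerm Q x)))
    rw [← linPerm_mul, mul_inv_cancel, linPerm_one]
  · rw [blockDiag_mem_AutLE]
    intro x
    change linPerm P⁻¹ (F (linPerm Q (linPerm D x))) = linPerm C (linPerm P⁻¹ (F (linPerm Q x)))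
    have hQD : Q * D = A ^ j * Q := by rw [hQ]; group
    have hPC : C * P⁻¹ = P⁻¹ * B ^ j := by rw [hP]; group
    rw [← linPerm_mul, hQD, linPerm_mul, hF, ← linPerm_mul, ← linPerm_mul, hPC]

theorem mem_primesOf {n : ℕ} (hn : n ∈ [6, 7, 8]) {A : GLn n} (hp : p.Prime)
    (hA : orderOf A = p) : p ∈ primesOf n := by
  have h1 : p ∣ Nat.card (GLn n) := hA ▸ orderOf_dvd_natCard A
  rw [Matrix.card_GL_field, (Nat.prime_iff.1 hp).dvd_finsetProd_iff, ZMod.card] at h1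
  obtain ⟨i, -, hi⟩ := h1
  refine mem_primesOf_of_dvd n hn i i.2 p ?_ hi hp
  have h2 : 0 < 2 ^ n - 2 ^ (i : ℕ) := Nat.sub_pos_of_lt (Nat.pow_lt_pow_right (by omega) i.2)
  have h3 := Nat.le_of_dvd h2 hi
  have h4 : 2 ^ n ≤ 256 := by
    fin_cases hn <;> norm_num
  have h5 : 0 < 2 ^ (i : ℕ) := by positivity
  omega

end Automorphisms

/-! ### The classification of pairs -/

section Classes

variable {n p : ℕ}

theorem exists_isRootFor_algebraicClosure (hp : p ∈ 2 :: oddPrimes) :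
    ∃ ζ : AlgebraicClosure F2, IsRootFor p ζ := exists_isRootFor hp

/-- Each member of `classes n` comes from an entry of the table, and has its types. -/
theorem exists_entry (hn : n ∈ [6, 7, 8]) {s : GLn n × GLn n} (hs : s ∈ classes n) :
    ∃ x ∈ typedTable n, IsMatrixOf s.1 x.1.1 ∧ IsMatrixOf s.2 x.1.2 := by
  obtain ⟨e, he, h1, h2⟩ := hs
  rw [← map_fst_typedTable n hn] at he
  obtain ⟨x, hx, rfl⟩ := List.mem_map.1 he
  exact ⟨x, hx, h1, h2⟩

theorem mem_classes (hn : n ∈ [6, 7, 8]) {s : GLn n × GLn n} {x} (hx : x ∈ typedTable n)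
    (h1 : IsMatrixOf s.1 x.1.1) (h2 : IsMatrixOf s.2 x.1.2) : s ∈ classes n :=
  ⟨x.1, map_fst_typedTable n hn ▸ List.mem_map_of_mem hx, h1, h2⟩

theorem pairType_of_mem {K : Type*} [Field K] [Algebra F2 K] {ζ : K} (hn : n ∈ [6, 7, 8])
    {s : GLn n × GLn n} {x} (hx : x ∈ typedTable n) (hζ : IsRootFor x.2.1 ζ)
    (h1 : IsMatrixOf s.1 x.1.1) (h2 : IsMatrixOf s.2 x.1.2) : PairType x.2.1 ζ s x.2.2 := by
  obtain ⟨-, h3, h4⟩ := formCheck_typedTable n hn x hx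
  have h5 := h3.hasType hζ h1
  have h6 := h4.hasType hζ h2
  exact ⟨h5.1, h6.1, h5.2, h6.2⟩

theorem not_extPowerSimilar (hn : n ∈ [6, 7, 8]) {s t : GLn n × GLn n} {x y}
    (hx : x ∈ typedTable n) (hy : y ∈ typedTable n) (hxy : x ≠ y)
    (hs1 : IsMatrixOf s.1 x.1.1) (hs2 : IsMatrixOf s.2 x.1.2)
    (ht1 : IsMatrixOf t.1 y.1.1) (ht2 : IsMatrixOf t.2 y.1.2) : ¬ ExtPowerSimilar s t := by
  intro h
  obtain ⟨ζ, hζ⟩ := exists_isRootFor_algebraicClosure (formCheck_typedTable n hn x hx).1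
  obtain ⟨ξ, hξ⟩ := exists_isRootFor_algebraicClosure (formCheck_typedTable n hn y hy).1
  have hs := pairType_of_mem hn hx hζ hs1 hs2
  have ht := pairType_of_mem hn hy hξ ht1 ht2
  have hp := hζ.prime
  have hq := hξ.prime
  rw [extPowerSimilar_iff hq.one_lt (ht.1 ▸ pow_orderOf_eq_one _)
    (ht.2 ▸ pow_orderOf_eq_one _)] at h
  -- a non-trivial power of an element of prime order `q` has order `q`
  have hpq : x.2.1 = y.2.1 := by
    have key {A C : GLn n} {i : ℕ} (hA : orderOf A = x.2.1) (hC : orderOf C = y.2.1)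
        (hAC : Similar A (C ^ i)) : x.2.1 = y.2.1 := by
      have hA1 : A ^ y.2.1 = 1 := by
        have := hAC.pow y.2.1
        rw [← pow_mul, mul_comm, pow_mul, ← hC, pow_orderOf_eq_one, one_pow] at this
        rw [← hC]
        exact this.eq_one
      have := orderOf_dvd_of_pow_eq_one hA1
      rw [hA] at this
      exact (Nat.prime_dvd_prime_iff_eq hp hq).1 this
    rcases h with ⟨i, -, h1, -⟩ | ⟨i, -, h1, -⟩
    · exact key hs.1 ht.1 h1
    · exact key hs.1 ht.2 h1
  have ht' := pairType_of_mem hn hy (hpq ▸ hζ) ht1 ht2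
  rw [← hpq] at ht'
  have hsymm : Std.Symm fun x y : (List (List ℕ) × List (List ℕ)) × ℕ × List ℕ × List ℕ =>
      x.2.1 = y.2.1 → ∀ i ∈ reps x.2.1,
      (¬ Related x.2.1 i x.2.2 y.2.2 ∧ ¬ Related x.2.1 i x.2.2 y.2.2.swap) ∧
      (¬ Related x.2.1 i y.2.2 x.2.2 ∧ ¬ Related x.2.1 i y.2.2 x.2.2.swap) :=
    ⟨fun x y h hyx i hi => (hyx ▸ h hyx.symm i (hyx ▸ hi)).symm⟩
  have hno := (pairwise_typedTable n hn).forall hx hy hxy hpq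
  rcases h with h | h
  · obtain ⟨i, hi, hi0, hr⟩ := hs.exists_related hζ ht' h
    obtain ⟨r, hr', hact⟩ := exists_rep_act hζ.mem hi hi0
    refine (hno r hr').1.1 ?_
    rwa [Related, hact, hact]
  · obtain ⟨i, hi, hi0, hr⟩ := hs.exists_related hζ ht'.swap h
    obtain ⟨r, hr', hact⟩ := exists_rep_act hζ.mem hi hi0
    refine (hno r hr').1.2 ?_
    rwa [Related, hact, hact]

theorem exists_matrices (hn : n ∈ [6, 7, 8]) {x} (hx : x ∈ typedTable n) :
    ∃ s : GLn n × GLn n, IsMatrixOf s.1 x.1.1 ∧ IsMatrixOf s.2 x.1.2 := by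
  obtain ⟨h0, h1, h2⟩ := formCheck_typedTable n hn x hx
  obtain ⟨ζ, hζ⟩ := exists_isRootFor_algebraicClosure h0
  obtain ⟨B, hB⟩ := h1.exists_isMatrixOf hζ
  obtain ⟨A, hA⟩ := h2.exists_isMatrixOf hζ
  exact ⟨(B, A), hB, hA⟩

theorem ncard_classes (hn : n ∈ [6, 7, 8]) : (classes n).ncard = (typedTable n).length := by
  choose! f hf using fun x (hx : x ∈ typedTable n) => exists_matrices hn hx
  have h1 : classes n = f '' ((typedTable n).toFinset : Set _) := by
    ext s
    constructor
    · intro hs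
      obtain ⟨x, hx, h1, h2⟩ := exists_entry hn hs
      exact ⟨x, by simpa using hx, Prod.ext ((hf x hx).1.unique h1) ((hf x hx).2.unique h2)⟩
    · rintro ⟨x, hx, rfl⟩
      have hx' : x ∈ typedTable n := by simpa using hx
      exact mem_classes hn hx' (hf x hx').1 (hf x hx').2
  rw [h1, Set.InjOn.ncard_image, Set.ncard_coe_finset,
    List.toFinset_card_of_nodup (nodup_typedTable n hn)]
  intro x hx y hy hxy
  have hx' : x ∈ typedTable n := by simpa using hx
  have hy' : y ∈ typedTable n := by simpa using hy
  by_contra hne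
  refine not_extPowerSimilar hn hx' hy' hne (hf x hx').1 (hf x hx').2 (hf y hy').1 (hf y hy').2 ?_
  rw [hxy]
  exact Or.inl ⟨1, one_pos, by rw [pow_one]; exact Similar.refl _,
    by rw [pow_one]; exact Similar.refl _⟩

theorem exists_extPowerSimilar (hn : n ∈ [6, 7, 8]) {F : Equiv.Perm (V n)} {A B : GLn n}
    (hp : p.Prime) (hA : orderOf A = p) (hB : orderOf B = p) (h : blockDiag (A, B) ∈ AutLE F) :
    ∃ t ∈ classes n, t.1 ^ p = 1 ∧ t.2 ^ p = 1 ∧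
      (PowerSimilar (B, A) t ∨ PowerSimilar (B, A) t.swap) := by
  have hpn := mem_primesOf hn hp hA
  obtain ⟨ζ, hζ⟩ := exists_isRootFor_algebraicClosure (primesOf_subset n hn p hpn)
  obtain ⟨LA, hLA⟩ := exists_hasType hζ (A : Matrix (Fin n) (Fin n) F2)
  obtain ⟨LB, hLB⟩ := exists_hasType hζ (B : Matrix (Fin n) (Fin n) F2)
  have hlen : LA.length = LB.length :=
    (hLA.mult_one_eq_iff hζ (coe_pow_eq_one hA) (coe_pow_eq_one hB) hLB).1
      (mult_one_eq_of_mem_AutLE h)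
  have hle := hLB.blockDim_mul_length_le hζ (coe_pow_eq_one hB)
  have hpos : 0 < blockDim p := by
    rcases hζ with rfl | hζ
    · decide
    · obtain ⟨-, -, -, h3, -⟩ := gen_spec p hζ.1
      exact h3
  have hne : LB.length ≠ 0 := fun h0 => by
    rw [List.length_eq_zero_iff.1 h0] at hLB
    have h1 : B = 1 := Units.ext (hLB.eq_one hζ (coe_pow_eq_one hB))
    rw [h1, orderOf_one] at hB
    exact hp.one_lt.ne hB
  obtain ⟨x, hx, hxp, hrel⟩ := exists_related n hn p hpn LB.length
    ((Nat.le_div_iff_mul_le hpos).2 (by rwa [mul_comm] at hle)) hne LB (mem_tuples hLB.1) LA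
    (hlen ▸ mem_tuples hLA.1)
  obtain ⟨t, ht1, ht2⟩ := exists_matrices hn hx
  have ht := pairType_of_mem hn hx (hxp ▸ hζ) ht1 ht2
  rw [hxp] at ht
  have hs : PairType p ζ (B, A) (LB, LA) := ⟨hB, hA, hLB, hLA⟩
  refine ⟨t, mem_classes hn hx ht1 ht2, ht.1 ▸ pow_orderOf_eq_one _,
    ht.2 ▸ pow_orderOf_eq_one _, ?_⟩
  rcases hrel with ⟨y, -, h0, hr⟩ | ⟨y, -, h0, hr⟩
  · exact Or.inl (hs.powerSimilar hζ ht (Nat.mod_lt _ hp.pos) h0 hr)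
  · exact Or.inr (hs.powerSimilar hζ ht.swap (Nat.mod_lt _ hp.pos) h0 hr)

end Classes
end LinSelfEquiv

open LinSelfEquiv in
theorem mainTheorem5 :
    -- the explicit lists of pairs `(B, A)` have 17, 27 and 32 elements
    ((classes 6).ncard = 17 ∧ (classes 7).ncard = 27 ∧ (classes 8).ncard = 32) ∧
    ∀ n : ℕ, n = 6 ∨ n = 7 ∨ n = 8 →
      -- in a listed pair, both matrices have the same prime order and are in rational canonical form
      (∀ B A : GLn n, (B, A) ∈ classes n →
        (∃ p : ℕ, p.Prime ∧ orderOf B = p ∧ orderOf A = p) ∧ IsRCF B ∧ IsRCF A) ∧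
      -- distinct listed pairs are not extended power-similar
      (∀ s ∈ classes n, ∀ t ∈ classes n, s ≠ t → ¬ ExtPowerSimilar s t) ∧
      -- the pair of each LE-automorphism of prime order is extended power-similar to a listed one
      (∀ (F : Equiv.Perm (V n)) (A B : GLn n) (p : ℕ), p.Prime → orderOf A = p → orderOf B = p →
        blockDiag (A, B) ∈ AutLE F → ∃ t ∈ classes n, ExtPowerSimilar (B, A) t) ∧
      -- each permutation with a non-trivial LE-automorphism is covered, up to linear equivalence
      -- and inversion, by a listed pair
      (∀ F : Equiv.Perm (V n), Nontrivial (AutLE F) →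
        ∃ G : Equiv.Perm (V n), (LinearEquivalent G F ∨ LinearEquivalent G (F⁻¹ : Equiv.Perm (V n))) ∧
          ∃ B A : GLn n, (B, A) ∈ classes n ∧ blockDiag (A, B) ∈ AutLE G) := by
  refine ⟨⟨?_, ?_, ?_⟩, fun n hn => ?_⟩
  · rw [ncard_classes (by simp)]; rfl
  · rw [ncard_classes (by simp)]; rfl
  · rw [ncard_classes (by simp)]; rfl
  replace hn : n ∈ [6, 7, 8] := by simpa using hn
  refine ⟨fun B A hs => ?_, fun s hs t ht hst => ?_, fun F A B p hp hA hB h => ?_, fun F hF => ?_⟩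
  · obtain ⟨x, hx, h1, h2⟩ := exists_entry hn hs
    obtain ⟨h0, h3, h4⟩ := formCheck_typedTable n hn x hx
    obtain ⟨ζ, hζ⟩ := exists_isRootFor_algebraicClosure h0
    exact ⟨⟨x.2.1, hζ.prime, (h3.hasType hζ h1).1, (h4.hasType hζ h2).1⟩, h3.isRCF h1, h4.isRCF h2⟩
  · obtain ⟨x, hx, h1, h2⟩ := exists_entry hn hs
    obtain ⟨y, hy, h3, h4⟩ := exists_entry hn ht
    refine not_extPowerSimilar hn hx hy ?_ h1 h2 h3 h4
    rintro rfl
    exact hst (Prod.ext (h1.unique h3) (h2.unique h4))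
  · obtain ⟨t, ht, h1, h2, h3⟩ := exists_extPowerSimilar hn hp hA hB h
    exact ⟨t, ht, (extPowerSimilar_iff hp.one_lt h1 h2).2 h3⟩
  · obtain ⟨p, A, B, hp, hA, hB, h⟩ := exists_prime_of_nontrivial hF
    obtain ⟨t, ht, h1, h2, h3 | h3⟩ := exists_extPowerSimilar hn hp hA hB h
    · obtain ⟨G, hG, hG'⟩ := exists_linearEquivalent hp hB h1 h2 h h3
      exact ⟨G, Or.inl hG, t.1, t.2, ht, hG'⟩
    · obtain ⟨G, hG, hG'⟩ := exists_linearEquivalent hp hA h1 h2 (AutLE_inv h) h3.swap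
      exact ⟨G, Or.inr hG, t.1, t.2, ht, hG'⟩
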